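/- Let $p\in(1,\infty)$. For an immersed planar curve $\gamma\in W^{2,p}(0,1;\mathbf{R}^2)$ (i.e. $\gamma'(t)\neq0$ for all $t\in[0,1]$, where $\gamma$ denotes the $C^1$ representative on $[0,1]$), let $\mathcal{L}[\gamma]=\int_0^1|\gamma'|\,dt$ be its length and let $\mathcal{B}_p[\gamma]=\int_\gamma|k|^p\,ds$ be its $p$-bending energy, where $k=\det(\gamma',\gamma'')/|\gamma'|^3$ is the signed curvature and $ds=|\gamma'|\,dt$. Such a $\gamma$ is called a $p$-elastica if there is $\lambda\in\mathbf{R}$ such that for every $\eta\in C_{\rm c}^\infty(0,1;\mathbf{R}^2)$ $$\frac{d}{d\varepsilon}\Big(\mathcal{B}_p[\gamma+\varepsilon\eta]+\lambda\mathcal{L}[\gamma+\varepsilon\eta]\Big)\Big|_{\varepsilon=0}=0.$$ A curve $\gamma$ is called analytic, respectively of class $C^n$, if its arclength parametrization $\tilde\gamma:[0,\mathcal{L}[\gamma]]\to\mathbf{R}^2$ is real analytic, respectively $n$ times continuously differentiable, on the closed interval $[0,\mathcal{L}[\gamma]]$. Then every $p$-elastica is analytic if and only if $p=\frac{2m}{2m-1}$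 for some integer $m\geq1$. If $p$ is not of this form, then there is a $p$-elastica that is not of class $C^{2+\lceil\frac{1}{p-1}\rceil}$. -/

import Mathlib

open Set MeasureTheory
open scoped ContDiff

noncomputable section

namespace PElastica

/-- The Euclidean plane. -/
abbrev Plane : Type := EuclideanSpace ℝ (Fin 2)

/-- Smooth functions `(0,1) → F` with compact support in `(0,1)`, extended by zero to `ℝ`. -/
def IsTest {F : Type*} [NormedAddCommGroup F] [NormedSpace ℝ F] (η : ℝ → F) : Prop :=
  ContDiff ℝ ∞ η ∧ HasCompactSupport η ∧ tsupport η ⊆ Ioo 0 1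

/-- `g` is a weak derivative of `f` on `(0,1)`. -/
def HasWeakDeriv (f g : ℝ → Plane) : Prop :=
  ∀ φ : ℝ → ℝ, IsTest φ →
    ∫ t in Ioo (0 : ℝ) 1, deriv φ t • f t = -∫ t in Ioo (0 : ℝ) 1, φ t • g t

/-- Membership in `L^p(0,1; ℝ²)`. -/
def MemL (p : ℝ) (f : ℝ → Plane) : Prop :=
  MemLp f (ENNReal.ofReal p) (volume.restrict (Ioo (0 : ℝ) 1))

/-- Membership in the Sobolev space `W^{2,p}(0,1; ℝ²)`. -/
def MemW2 (p : ℝ) (γ : ℝ → Plane) : Prop :=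
  MemL p γ ∧ ∃ v a : ℝ → Plane, MemL p v ∧ MemL p a ∧ HasWeakDeriv γ v ∧ HasWeakDeriv v a

/-- `W^{2,p}`-immersed curves on `[0,1]`. Only the values of `γ` on `[0,1]` matter.
An element of `W^{2,p}(0,1)` is represented by its continuous representative on `[0,1]`, which is
automatically `C¹` on `[0,1]`. -/
structure IsImmersedW2 (p : ℝ) (γ : ℝ → Plane) : Prop where
  continuousOn : ContinuousOn γ (Icc 0 1)
  memW2 : MemW2 p γ
  derivWithin_ne_zero : ∀ t ∈ Icc (0 : ℝ) 1, derivWithin γ (Icc 0 1) t ≠ 0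

/-- Signed (counterclockwise) curvature `det(γ', γ'') / |γ'|³` of a parametrized curve.
For a `W^{2,p}`-immersed curve, `γ'` is absolutely continuous, so that it is differentiable at
almost every point of `(0,1)` and its derivative there is the weak second derivative of `γ`. -/
def curvature (γ : ℝ → Plane) (t : ℝ) : ℝ :=
  (deriv γ t 0 * deriv (deriv γ) t 1 - deriv γ t 1 * deriv (deriv γ) t 0) / ‖deriv γ t‖ ^ 3

/-- The `p`-bending energy `∫_γ |k|^p ds`, with `ds = |γ'| dt`. -/
def bendingEnergy (p : ℝ) (γ : ℝ → Plane) : ℝ :=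
  ∫ t in Ioo (0 : ℝ) 1, |curvature γ t| ^ p * ‖deriv γ t‖

/-- The arclength of the part of the curve between the parameters `0` and `t`. -/
def arclength (γ : ℝ → Plane) (t : ℝ) : ℝ :=
  ∫ u in (0 : ℝ)..t, ‖deriv γ u‖

/-- The length of the curve `γ : [0,1] → ℝ²`. -/
def length (γ : ℝ → Plane) : ℝ := arclength γ 1

/-- The arclength parametrization `γ ∘ σ⁻¹ : [0, L] → ℝ²`, where `σ : [0,1] → [0,L]` is the
arclength function of `γ` (a bijection if `γ` is immersed). -/
def arclengthParam (γ : ℝ → Plane) (s : ℝ) : Plane :=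
  γ (Function.invFunOn (arclength γ) (Icc 0 1) s)

/-- `p`-elasticae: `W^{2,p}`-immersed curves which, for some `lam`, are critical points of
`bendingEnergy p + lam * length` with respect to smooth compactly supported variations. -/
def IsPElastica (p : ℝ) (γ : ℝ → Plane) : Prop :=
  IsImmersedW2 p γ ∧
    ∃ lam : ℝ, ∀ η : ℝ → Plane, IsTest η →
      HasDerivAt (fun ε : ℝ => bendingEnergy p (fun t => γ t + ε • η t)
        + lam * length (fun t => γ t + ε • η t)) 0 0

/-- The curve is (real) analytic: its arclength parametrization is analytic on `[0,L]`, up to and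
including the endpoints. -/
def IsAnalyticCurve (γ : ℝ → Plane) : Prop :=
  AnalyticOn ℝ (arclengthParam γ) (Icc 0 (length γ))

/-- The curve is of class `C^n`: its arclength parametrization is `C^n` on `[0,L]`. -/
def IsClassC (n : ℕ) (γ : ℝ → Plane) : Prop :=
  ContDiffOn ℝ n (arclengthParam γ) (Icc 0 (length γ))

end PElastica

end

/-! Write `w = |k|^{p-2} k` and `r = 1/(p-1)`, so that `k = |w|^{r-1} w`. Everything rests on the
Euler-Lagrange equation in integrated form: along an elastica `w` is an affine function of the
position (`exists_oddPow_kappa_eq_affine`). The energy is differentiated under the integral sign;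
testing with each coordinate direction and applying a second order du Bois-Reymond lemma gives `A =
F` almost everywhere with `F' = B + C`, where `A` and `B` are the coefficients of `η''` and `η'`.
The cross product of the velocity with the vector `F` equals `p w`, and in its derivative everything
cancels except a constant combination of the velocity components. This reflects the invariance of
the energy under translations and rotations.

If `p = 2m/(2m-1)`, then `r = 2m-1` is an odd integer and `k` is the `r`-th power of an affine
function of the position. In arclength, position and unit tangent then solve a polynomial ODE on the
closed interval `[0,L]`. Such solutions are analytic up to the endpoints
(`analyticWithinAt_of_polynomial_ode`), by the analytic inverse function theorem in a space of
continuous functions.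

For the converse take the rectangular elastica, with multiplier zero and `k = -|y|^{r-1} y`, where
`y` is the height above the inflection point (`exists_rectangular_elastica`). The cosine of its
tangent angle is `f(y) = |y|^{r+1}/(r+1)`. If its arclength parametrization is `C^{n+2}`, then so
are the height as a function of arclength and its local inverse, while `dx/ds` is `f` of the height;
hence `f` is `C^{n+1}` at the origin (`contDiffAt_profile_of_isClassC`). For `n = ⌈r⌉` this forces
`r+1` to be an even integer (`eq_of_contDiffAt_abs_rpow`), which is `p = 2m/(2m-1)`. Analytic curves
are of every class `C^n`, so this single example yields both the failure of analyticity and the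
quantitative statement. -/

noncomputable section

namespace PElastica

open Filter Topology

/-! ### Polynomial ODEs: analyticity up to the endpoints of the interval. -/

section PolynomialOde

open unitInterval

/-- Primitive of a continuous function on `[0,1]`, as a function on `[0,1]`. -/
def primitiveFun (h : C(I, ℝ)) : C(I, ℝ) where
  toFun s := ∫ r in (0 : ℝ)..s, IccExtend zero_le_one h r
  continuous_toFun := by
    have h1 : Continuous (IccExtend (zero_le_one (α := ℝ)) h) := h.continuous.Icc_extend'
    exact (intervalIntegral.continuous_primitive (fun a b => h1.intervalIntegrable a b) 0).comp
      continuous_subtype_val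

/-- Integration from `0`, as a continuous linear operator on `C([0,1])`. -/
def primitiveCLM : C(I, ℝ) →L[ℝ] C(I, ℝ) :=
  LinearMap.mkContinuous
    { toFun := primitiveFun
      map_add' := fun f g => by
        ext s
        have hf : Continuous (IccExtend (zero_le_one (α := ℝ)) f) := f.continuous.Icc_extend'
        have hg : Continuous (IccExtend (zero_le_one (α := ℝ)) g) := g.continuous.Icc_extend'
        change (∫ r in (0 : ℝ)..s, (IccExtend (zero_le_one (α := ℝ)) f r
          + IccExtend (zero_le_one (α := ℝ)) g r)) = _
        rw [intervalIntegral.integral_add (hf.intervalIntegrable _ _) (hg.intervalIntegrable _ _)]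
        rfl
      map_smul' := fun c f => by
        ext s
        change (∫ r in (0 : ℝ)..s, (c * IccExtend (zero_le_one (α := ℝ)) f r)) = _
        rw [intervalIntegral.integral_const_mul]
        rfl } 1 (by
    intro f
    rw [one_mul]
    refine (ContinuousMap.norm_le _ (norm_nonneg _)).2 fun s => ?_
    refine (intervalIntegral.norm_integral_le_of_norm_le_const (C := ‖f‖)
      fun r _ => f.norm_coe_le_norm _).trans ?_
    have hs := s.2
    rw [sub_zero, abs_of_nonneg hs.1]
    exact mul_le_of_le_one_right (norm_nonneg _) hs.2)

theorem primitiveCLM_apply (h : C(I, ℝ)) (s : I) :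
    primitiveCLM h s = ∫ r in (0 : ℝ)..s, IccExtend zero_le_one h r := rfl

/-- With `A = C([0,1])` this is the substitution operator `X ↦ P(X)`. For a polynomial it uses only
the algebra operations, so its analyticity is immediate. -/
theorem contDiff_aeval {ι : Type*} [Fintype ι] {A : Type*} [NormedCommRing A] [NormedAlgebra ℝ A]
    (P : MvPolynomial ι ℝ) {n : WithTop ℕ∞} :
    ContDiff ℝ n (fun X : ι → A => MvPolynomial.aeval X P) := by
  induction P using MvPolynomial.induction_on with
  | C a => simpa using contDiff_const
  | add p q hp hq => simpa using hp.add hq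
  | mul_X p i hp => simpa using hp.mul (contDiff_apply ℝ A i)

theorem aeval_continuousMap_apply {ι : Type*} (X : ι → C(I, ℝ)) (P : MvPolynomial ι ℝ) (s : I) :
    MvPolynomial.aeval X P s = MvPolynomial.eval (fun i => X i s) P := by
  induction P using MvPolynomial.induction_on with
  | C a => simp
  | add p q hp hq => simp [hp, hq]
  | mul_X p i hp => simp [hp]

/-- The map whose zero set (in the second component, up to the initial value) consists of the
rescaled solutions of the polynomial system `x' = P(x)`. -/
def rescaledOde {ι : Type*} [Fintype ι] (P : ι → MvPolynomial ι ℝ) (z : ℝ × (ι → C(I, ℝ))) :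
    ℝ × (ι → C(I, ℝ)) :=
  (z.1, z.2 - z.1 • fun i => primitiveCLM (MvPolynomial.aeval z.2 (P i)))

theorem contDiff_rescaledOde {ι : Type*} [Fintype ι] (P : ι → MvPolynomial ι ℝ)
    {n : WithTop ℕ∞} : ContDiff ℝ n (rescaledOde P) := by
  refine contDiff_fst.prodMk (contDiff_snd.sub (contDiff_fst.smul (contDiff_pi.2 fun i => ?_)))
  exact primitiveCLM.contDiff.comp ((contDiff_aeval (P i)).comp contDiff_snd)

/-- At `ε = 0` the derivative of the integral term with respect to `X` carries the factor `ε` and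
drops out. What remains is a shear, hence invertible, whatever `P` is. -/
theorem hasFDerivAt_rescaledOde {ι : Type*} [Fintype ι] (P : ι → MvPolynomial ι ℝ)
    (X : ι → C(I, ℝ)) :
    HasFDerivAt (rescaledOde P) (((ContinuousLinearEquiv.refl ℝ ℝ).skewProd
      (ContinuousLinearEquiv.refl ℝ (ι → C(I, ℝ))) (ContinuousLinearMap.toSpanSingleton ℝ
        (-fun i => primitiveCLM (MvPolynomial.aeval X (P i)))) :
          (ℝ × (ι → C(I, ℝ))) ≃L[ℝ] (ℝ × (ι → C(I, ℝ)))) :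
        (ℝ × (ι → C(I, ℝ))) →L[ℝ] (ℝ × (ι → C(I, ℝ)))) (0, X) := by
  have hG : ContDiff ℝ 1 (fun z : ℝ × (ι → C(I, ℝ)) =>
      (fun i => primitiveCLM (MvPolynomial.aeval z.2 (P i)) : ι → C(I, ℝ))) :=
    contDiff_pi.2 fun i => primitiveCLM.contDiff.comp ((contDiff_aeval (P i)).comp contDiff_snd)
  have hG' := ((hG.differentiable one_ne_zero) (0, X)).hasFDerivAt
  have h1 := (hasFDerivAt_fst (𝕜 := ℝ) (p := ((0 : ℝ), X)))
  have h2 := (hasFDerivAt_snd (𝕜 := ℝ) (p := ((0 : ℝ), X)))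
  have h3 := h1.prodMk (h2.sub (h1.smul hG'))
  refine h3.congr_fderiv ?_
  ext z <;> simp

/-- The rescaled curve `X(s) = x(t₀ + ε s)` on `[0,1]` satisfies `X = x(t₀) + ε ∫ P(X)`, so
`rescaledOde P` sends `(ε, X)` to `(ε, x(t₀))`. The analytic local inverse recovers `X` from `ε`,
and evaluation at `s = 1` gives `x(t₀ + ε)` as an analytic function of `ε`. Time has become a
parameter, so `t₀` may be an endpoint. -/
theorem analyticWithinAt_of_polynomial_ode {ι : Type*} [Fintype ι] (P : ι → MvPolynomial ι ℝ)
    {a b : ℝ} (hab : a ≤ b) (x : ι → ℝ → ℝ)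
    (hx : ∀ i, ∀ t ∈ Icc a b,
      HasDerivWithinAt (x i) (MvPolynomial.eval (fun j => x j t) (P i)) (Icc a b) t)
    {t₀ : ℝ} (ht₀ : t₀ ∈ Icc a b) (i : ι) : AnalyticWithinAt ℝ (x i) (Icc a b) t₀ := by
  have hcont : ∀ i, ContinuousOn (x i) (Icc a b) := fun i t ht => (hx i t ht).continuousWithinAt
  let xe : ι → C(ℝ, ℝ) := fun i => ⟨IccExtend hab ((Icc a b).domRestrict (x i)),
    (continuousOn_iff_continuous_domRestrict.1 (hcont i)).Icc_extend'⟩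
  have xe_eq : ∀ i, ∀ t ∈ Icc a b, xe i t = x i t := fun i t ht => by
    exact IccExtend_of_mem hab ((Icc a b).domRestrict (x i)) ht
  -- Currying makes `ε ↦ Y i ε` continuous for the sup norm, which is what brings the rescaled
  -- solutions into the domain of the local inverse.
  let Y : ι → C(ℝ, C(I, ℝ)) := fun i =>
    ContinuousMap.curry ⟨fun q : ℝ × I => xe i (t₀ + q.1 * q.2), by fun_prop⟩
  have hY : ∀ i ε s, Y i ε s = xe i (t₀ + ε * s) := fun i ε s => rfl
  let X₀ : ι → C(I, ℝ) := fun i => ContinuousMap.const I (x i t₀)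
  have hY0 : (fun i => Y i 0) = X₀ := by
    ext i s
    simp [hY, X₀, xe_eq i t₀ ht₀]
  have seg : ∀ ε, t₀ + ε ∈ Icc a b → ∀ s ∈ Icc (0 : ℝ) 1, t₀ + ε * s ∈ Icc a b := by
    intro ε hε s hs
    have := (convex_Icc a b) ht₀ hε (sub_nonneg.2 hs.2) hs.1 (by ring)
    convert this using 1
    simp only [smul_eq_mul]; ring
  have key : ∀ ε, t₀ + ε ∈ Icc a b → rescaledOde P (ε, fun i => Y i ε) = (ε, X₀) := by
    intro ε hε
    refine Prod.ext rfl ?_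
    funext i
    ext s
    have hint : ∫ r in (0 : ℝ)..s, ε * MvPolynomial.eval (fun j => xe j (t₀ + ε * r)) (P i)
        = xe i (t₀ + ε * s) - xe i (t₀ + ε * 0) := by
      refine intervalIntegral.integral_eq_sub_of_hasDerivAt_of_le s.2.1
        (f := fun r => xe i (t₀ + ε * r)) (by fun_prop) ?_ ?_
      · intro r hr
        have hr' : r ∈ Icc (0 : ℝ) 1 := ⟨hr.1.le, hr.2.le.trans s.2.2⟩
        have h1 : HasDerivWithinAt (xe i) (MvPolynomial.eval (fun j => xe j (t₀ + ε * r)) (P i))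
            (Icc a b) (t₀ + ε * r) := by
          have := (hx i _ (seg ε hε r hr')).congr (fun y hy => xe_eq i y hy)
            (xe_eq i _ (seg ε hε r hr'))
          simpa only [xe_eq _ _ (seg ε hε r hr')] using this
        have h2 : HasDerivWithinAt (fun r => t₀ + ε * r) ε (Icc 0 1) r := by
          simpa using (((hasDerivAt_id r).const_mul ε).const_add t₀).hasDerivWithinAt
        have h3 := h1.scomp r h2 (seg ε hε)
        refine (h3.hasDerivAt (Icc_mem_nhds hr.1 (hr.2.trans_le s.2.2)))
      · refine Continuous.intervalIntegrable ?_ _ _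
        refine continuous_const.mul ?_
        exact (MvPolynomial.continuous_eval (P i)).comp (by fun_prop)
    have hprim : primitiveCLM (MvPolynomial.aeval (fun j => Y j ε) (P i)) s
        = ∫ r in (0 : ℝ)..s, MvPolynomial.eval (fun j => xe j (t₀ + ε * r)) (P i) := by
      rw [primitiveCLM_apply]
      refine intervalIntegral.integral_congr fun r hr => ?_
      rw [uIcc_of_le s.2.1] at hr
      have hr' : r ∈ Icc (0 : ℝ) 1 := ⟨hr.1, hr.2.trans s.2.2⟩
      rw [IccExtend_of_mem _ _ hr', aeval_continuousMap_apply]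
      rfl
    rw [intervalIntegral.integral_const_mul] at hint
    simp only [rescaledOde, Pi.sub_apply, Pi.smul_apply, ContinuousMap.coe_sub,
      ContinuousMap.coe_smul, smul_eq_mul, hprim, hint]
    rw [hY, mul_zero, add_zero, xe_eq i t₀ ht₀]
    simp [X₀]
  have hC : ContDiffAt ℝ ω (rescaledOde P) (0, X₀) := (contDiff_rescaledOde P).contDiffAt
  have hF := hasFDerivAt_rescaledOde P X₀
  have hω : (ω : WithTop ℕ∞) ≠ 0 := by simp
  set g := hC.localInverse hF hω with hg
  have h0 : rescaledOde P (0, X₀) = (0, X₀) := by simp [rescaledOde]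
  have hgan : ContDiffAt ℝ ω g (0, X₀) := by
    have := hC.to_localInverse hF hω
    rwa [h0] at this
  have hleft : ∀ᶠ z in 𝓝 (0, X₀), g (rescaledOde P z) = z :=
    (hC.hasStrictFDerivAt' hF hω).eventually_left_inverse
  have htend : Tendsto (fun t => (t - t₀, fun i => Y i (t - t₀))) (𝓝[Icc a b] t₀)
      (𝓝 ((0 : ℝ), X₀)) := by
    have hc : Continuous fun t => (t - t₀, fun i => Y i (t - t₀)) := by fun_prop
    have := hc.tendsto t₀
    simp only [sub_self, hY0] at this
    exact this.mono_left nhdsWithin_le_nhds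
  have hcomp : ContDiffAt ℝ ω (fun t : ℝ => (g (t - t₀, X₀)).2 i 1) t₀ := by
    have h1 : ContDiffAt ℝ ω (fun t : ℝ => (t - t₀, X₀)) t₀ := by fun_prop
    have h2 : ContDiffAt ℝ ω (fun t : ℝ => g (t - t₀, X₀)) t₀ := by
      refine ContDiffAt.comp t₀ ?_ h1
      rw [sub_self]; exact hgan
    have h3 : ContDiff ℝ ω (fun z : ℝ × (ι → C(I, ℝ)) => z.2 i 1) :=
      ((ContinuousMap.evalCLM ℝ (1 : I)).comp
        ((ContinuousLinearMap.proj i).comp (ContinuousLinearMap.snd ℝ ℝ (ι → C(I, ℝ))))).contDiff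
    exact h3.contDiffAt.comp t₀ h2
  have han : AnalyticAt ℝ (fun t : ℝ => (g (t - t₀, X₀)).2 i 1) t₀ := hcomp.analyticAt
  have hev : ∀ t ∈ Icc a b, g (rescaledOde P (t - t₀, fun i => Y i (t - t₀)))
      = (t - t₀, fun i => Y i (t - t₀)) → x i t = (g (t - t₀, X₀)).2 i 1 := by
    intro t ht h
    rw [key (t - t₀) (by simpa using ht)] at h
    rw [h, hY]
    simp [xe_eq i t ht]
  refine han.analyticWithinAt.congr_of_eventuallyEq_insert ?_
  rw [insert_eq_of_mem ht₀]
  filter_upwards [htend.eventually hleft, self_mem_nhdsWithin] with t h1 h2 using hev t h2 h1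

end PolynomialOde

/-! ### Test functions, du Bois-Reymond lemmas and absolutely continuous representatives. -/

theorem setIntegral_Ioo_eq (f : ℝ → ℝ) : ∫ t in Ioo (0 : ℝ) 1, f t = ∫ t in (0 : ℝ)..1, f t := by
  rw [intervalIntegral.integral_of_le zero_le_one, integral_Ioc_eq_integral_Ioo]

theorem intervalIntegrable_of_Ioo {f : ℝ → ℝ} (hf : IntegrableOn f (Ioo 0 1)) :
    IntervalIntegrable f volume 0 1 :=
  (intervalIntegrable_iff_integrableOn_Ioo_of_le zero_le_one).2 hf

theorem IsTest.zero_of_notMem {F : Type*} [NormedAddCommGroup F] [NormedSpace ℝ F] {φ : ℝ → F}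
    (hφ : IsTest φ) {t : ℝ} (ht : t ∉ Ioo (0 : ℝ) 1) : φ t = 0 :=
  image_eq_zero_of_notMem_tsupport fun h => ht (hφ.2.2 h)

theorem IsTest.continuous {F : Type*} [NormedAddCommGroup F] [NormedSpace ℝ F] {φ : ℝ → F}
    (hφ : IsTest φ) : Continuous φ := hφ.1.continuous

theorem IsTest.differentiable {F : Type*} [NormedAddCommGroup F] [NormedSpace ℝ F] {φ : ℝ → F}
    (hφ : IsTest φ) : Differentiable ℝ φ := hφ.1.differentiable (by simp)

theorem IsTest.deriv {F : Type*} [NormedAddCommGroup F] [NormedSpace ℝ F] {φ : ℝ → F}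
    (hφ : IsTest φ) : IsTest (deriv φ) :=
  ⟨(contDiff_infty_iff_deriv.1 hφ.1).2, hφ.2.1.deriv,
    tsupport_deriv_subset.trans hφ.2.2⟩

theorem IsTest.bound {F : Type*} [NormedAddCommGroup F] [NormedSpace ℝ F] {φ : ℝ → F}
    (hφ : IsTest φ) : ∃ C, ∀ t, ‖φ t‖ ≤ C :=
  hφ.continuous.bounded_above_of_compact_support hφ.2.1

theorem IsTest.smul_const {F : Type*} [NormedAddCommGroup F] [NormedSpace ℝ F] {φ : ℝ → ℝ}
    (hφ : IsTest φ) (v : F) : IsTest (fun t => φ t • v) :=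
  ⟨hφ.1.smul contDiff_const, hφ.2.1.smul_right,
    (closure_mono (Function.support_smul_subset_left φ fun _ => v)).trans hφ.2.2⟩

theorem IsTest.add {φ ψ : ℝ → ℝ} (hφ : IsTest φ) (hψ : IsTest ψ) :
    IsTest (fun t => φ t + ψ t) :=
  ⟨hφ.1.add hψ.1, hφ.2.1.add hψ.2.1,
    (tsupport_add φ ψ).trans (union_subset hφ.2.2 hψ.2.2)⟩

theorem IsTest.integrable_mul {φ f : ℝ → ℝ} (hφ : IsTest φ) (hf : IntegrableOn f (Ioo 0 1)) :
    IntegrableOn (fun t => φ t * f t) (Ioo 0 1) := by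
  obtain ⟨C, hC⟩ := hφ.bound
  exact hf.bdd_mul hφ.continuous.aestronglyMeasurable (Eventually.of_forall hC)

/-- A test function of zero mean is the derivative of a test function. -/
theorem IsTest.exists_deriv_eq {φ : ℝ → ℝ} (hφ : IsTest φ)
    (h0 : ∫ t in (0 : ℝ)..1, φ t = 0) : ∃ χ : ℝ → ℝ, IsTest χ ∧ _root_.deriv χ = φ := by
  have hd : ∀ t, HasDerivAt (fun t => ∫ s in (0 : ℝ)..t, φ s) (φ t) t := fun t =>
    intervalIntegral.integral_hasDerivAt_right (hφ.continuous.intervalIntegrable _ _)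
      (hφ.continuous.stronglyMeasurableAtFilter _ _) hφ.continuous.continuousAt
  have hderiv : _root_.deriv (fun t => ∫ s in (0 : ℝ)..t, φ s) = φ := funext fun t => (hd t).deriv
  -- The point `1/2` only serves to keep the compact set nonempty when `φ = 0`.
  have hne : (insert (1 / 2) (tsupport φ)).Nonempty := insert_nonempty _ _
  have hK : IsCompact (insert (1 / 2) (tsupport φ)) := hφ.2.1.isCompact.insert _
  have hsub : insert (1 / 2) (tsupport φ) ⊆ Ioo (0 : ℝ) 1 :=
    insert_subset (by norm_num) hφ.2.2
  obtain ⟨c, hc, hcl⟩ := hK.exists_isLeast hne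
  obtain ⟨d, hdm, hdl⟩ := hK.exists_isGreatest hne
  have hzero : ∀ t, t ∉ Icc c d → φ t = 0 := fun t ht =>
    image_eq_zero_of_notMem_tsupport fun h =>
      ht ⟨hcl (mem_insert_of_mem _ h), hdl (mem_insert_of_mem _ h)⟩
  have hsupp : tsupport (fun t => ∫ s in (0 : ℝ)..t, φ s) ⊆ Icc c d := by
    refine closure_minimal (fun t ht => ?_) isClosed_Icc
    by_contra hcon
    refine ht ?_
    rw [mem_Icc, not_and_or, not_le, not_le] at hcon
    have h01c := hsub hc
    have h01d := hsub hdm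
    rcases hcon with h | h
    · refine intervalIntegral.integral_zero_ae (Eventually.of_forall fun s hs => hzero s ?_)
      rintro ⟨h1, h2⟩
      rcases (mem_uIoc.1 hs) with h3 | h3
      · linarith
      · linarith [h01c.1]
    · have h2 : ∫ s in t..1, φ s = 0 := by
        refine intervalIntegral.integral_zero_ae (Eventually.of_forall fun s hs => hzero s ?_)
        rintro ⟨h1, h2⟩
        rcases (mem_uIoc.1 hs) with h3 | h3
        · linarith
        · linarith [h01d.2]
      have := intervalIntegral.integral_add_adjacent_intervals
        (hφ.continuous.intervalIntegrable (μ := volume) 0 t)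
        (hφ.continuous.intervalIntegrable t 1)
      change ∫ s in (0 : ℝ)..t, φ s = 0
      linarith
  refine ⟨_, ⟨contDiff_infty_iff_deriv.2 ⟨fun t => (hd t).differentiableAt, by rw [hderiv]; exact hφ.1⟩,
    isCompact_Icc.of_isClosed_subset (isClosed_tsupport _) hsupp, hsupp.trans ?_⟩, hderiv⟩
  exact Icc_subset_Ioo (hsub hc).1 (hsub hdm).2

theorem exists_isTest_integral_eq_one :
    ∃ ψ : ℝ → ℝ, IsTest ψ ∧ ∫ t in (0 : ℝ)..1, ψ t = 1 := by
  let B : ContDiffBump (1 / 2 : ℝ) := ⟨1 / 8, 1 / 4, by norm_num, by norm_num⟩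
  have hsub : tsupport (B.normed volume) ⊆ Ioo (0 : ℝ) 1 := by
    rw [B.tsupport_normed_eq]
    intro t ht
    have h1 : |t - 1 / 2| ≤ 1 / 4 := ht
    rw [abs_le] at h1
    constructor <;> linarith [h1.1, h1.2]
  have ht : IsTest (B.normed volume) := ⟨B.contDiff_normed, B.hasCompactSupport_normed, hsub⟩
  refine ⟨_, ht, ?_⟩
  rw [← setIntegral_Ioo_eq, setIntegral_eq_integral_of_forall_compl_eq_zero
    fun t h => ht.zero_of_notMem h]
  exact B.integral_normed

/-- Decomposition of a test function into a derivative of a test function and a multiple of a fixed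
test function. -/
theorem IsTest.decompose {ψ φ : ℝ → ℝ} (hψ : IsTest ψ) (h1 : ∫ t in (0 : ℝ)..1, ψ t = 1)
    (hφ : IsTest φ) :
    ∃ χ : ℝ → ℝ, IsTest χ ∧ ∀ t, φ t = _root_.deriv χ t + (∫ s in (0 : ℝ)..1, φ s) * ψ t := by
  set c := ∫ s in (0 : ℝ)..1, φ s with hc
  have ht : IsTest (fun t => φ t + ψ t • (-c)) := hφ.add (hψ.smul_const _)
  obtain ⟨χ, hχ, hd⟩ := ht.exists_deriv_eq (by
    rw [intervalIntegral.integral_add (hφ.continuous.intervalIntegrable _ _)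
      ((hψ.smul_const (-c)).continuous.intervalIntegrable _ _)]
    simp only [smul_eq_mul]
    rw [intervalIntegral.integral_mul_const, h1]
    ring)
  refine ⟨χ, hχ, fun t => ?_⟩
  rw [hd]
  simp only [smul_eq_mul]
  ring

/-- The lemma of du Bois-Reymond. -/
theorem ae_eq_const_of_integral_deriv_mul {f : ℝ → ℝ} (hf : IntegrableOn f (Ioo 0 1))
    (h : ∀ φ : ℝ → ℝ, IsTest φ → ∫ t in (0 : ℝ)..1, deriv φ t * f t = 0) :
    ∃ c, ∀ᵐ t, t ∈ Ioo (0 : ℝ) 1 → f t = c := by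
  obtain ⟨ψ, hψ, hψ1⟩ := exists_isTest_integral_eq_one
  set c := ∫ t in (0 : ℝ)..1, ψ t * f t with hc
  refine ⟨c, ?_⟩
  have hfc : IntegrableOn (fun t => f t - c) (Ioo 0 1) := hf.sub (by simp)
  have := isOpen_Ioo.ae_eq_zero_of_integral_contDiff_smul_eq_zero hfc.locallyIntegrableOn ?_
  · filter_upwards [this] with t ht h1 using sub_eq_zero.1 (ht h1)
  intro φ h1 h2 h3
  have hφ : IsTest φ := ⟨h1, h2, h3⟩
  obtain ⟨χ, hχ, hd⟩ := hψ.decompose hψ1 hφ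
  set e := ∫ s in (0 : ℝ)..1, φ s with he
  rw [← setIntegral_eq_integral_of_forall_compl_eq_zero (s := Ioo (0 : ℝ) 1)
    fun t h => by rw [hφ.zero_of_notMem h, zero_smul], setIntegral_Ioo_eq]
  have : ∀ t, φ t • (f t - c) = deriv χ t * f t + e * (ψ t * f t) - c * φ t := by
    intro t
    simp only [smul_eq_mul]
    rw [mul_sub]
    nth_rewrite 1 [hd t]
    ring
  simp_rw [this]
  have i1 := intervalIntegrable_of_Ioo (hχ.deriv.integrable_mul hf)
  have i2 := intervalIntegrable_of_Ioo (hψ.integrable_mul hf)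
  have i3 : IntervalIntegrable φ volume 0 1 := hφ.continuous.intervalIntegrable _ _
  rw [intervalIntegral.integral_sub (i1.add (i2.const_mul _)) (i3.const_mul _),
    intervalIntegral.integral_add i1 (i2.const_mul _), h χ hχ,
    intervalIntegral.integral_const_mul, intervalIntegral.integral_const_mul, ← he, ← hc]
  ring

theorem IsTest.absolutelyContinuous {φ : ℝ → ℝ} (hφ : IsTest φ) :
    AbsolutelyContinuousOnInterval φ 0 1 :=
  (hφ.1.of_le (by exact_mod_cast le_top)).contDiffOn.absolutelyContinuousOnInterval

theorem IsTest.integral_deriv_mul {φ F : ℝ → ℝ} (hφ : IsTest φ)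
    (hF : AbsolutelyContinuousOnInterval F 0 1) :
    ∫ t in (0 : ℝ)..1, _root_.deriv φ t * F t = -∫ t in (0 : ℝ)..1, φ t * _root_.deriv F t := by
  rw [hφ.absolutelyContinuous.integral_mul_deriv_eq_deriv_mul hF,
    hφ.zero_of_notMem (t := 0) (by simp), hφ.zero_of_notMem (t := 1) (by simp)]
  ring

/-- An integrable function with an integrable weak derivative agrees almost everywhere with an
absolutely continuous function. -/
theorem exists_absolutelyContinuous_of_weakDeriv {f g : ℝ → ℝ} (hf : IntegrableOn f (Ioo 0 1))
    (hg : IntegrableOn g (Ioo 0 1))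
    (h : ∀ φ : ℝ → ℝ, IsTest φ →
      ∫ t in (0 : ℝ)..1, deriv φ t * f t = -∫ t in (0 : ℝ)..1, φ t * g t) :
    ∃ F : ℝ → ℝ, AbsolutelyContinuousOnInterval F 0 1 ∧ (∀ᵐ t, t ∈ Ioo (0 : ℝ) 1 → f t = F t) ∧
      ∀ᵐ t, t ∈ Ioo (0 : ℝ) 1 → HasDerivAt F (g t) t := by
  have hgi := intervalIntegrable_of_Ioo hg
  have hac := hgi.absolutelyContinuousOnInterval_intervalIntegral (c := 0) (by simp)
  have hder : ∀ᵐ t, t ∈ Ioo (0 : ℝ) 1 →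
      HasDerivAt (fun x => ∫ v in (0 : ℝ)..x, g v) (g t) t := by
    filter_upwards [hgi.ae_hasDerivAt_integral] with t ht h1
    refine ht ?_ 0 (by simp)
    rw [uIcc_of_le zero_le_one]
    exact Ioo_subset_Icc_self h1
  set G := fun x => ∫ v in (0 : ℝ)..x, g v with hG
  have hGi : IntegrableOn G (Ioo 0 1) := by
    have := hac.continuousOn
    rw [uIcc_of_le zero_le_one] at this
    exact (this.integrableOn_Icc).mono_set Ioo_subset_Icc_self
  -- `f` minus the primitive of `g` has vanishing weak derivative, hence is constant.
  obtain ⟨c, hc⟩ := ae_eq_const_of_integral_deriv_mul (hf.sub hGi) fun φ hφ => by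
    have i1 := intervalIntegrable_of_Ioo (hφ.deriv.integrable_mul hf)
    have i2 := intervalIntegrable_of_Ioo (hφ.deriv.integrable_mul hGi)
    simp only [Pi.sub_apply, mul_sub]
    rw [intervalIntegral.integral_sub i1 i2, h φ hφ, hφ.integral_deriv_mul hac]
    have : ∫ t in (0 : ℝ)..1, φ t * deriv G t = ∫ t in (0 : ℝ)..1, φ t * g t := by
      rw [← setIntegral_Ioo_eq, ← setIntegral_Ioo_eq]
      refine setIntegral_congr_ae measurableSet_Ioo ?_
      filter_upwards [hder] with t ht h1
      rw [(ht h1).deriv]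
    rw [this]; ring
  refine ⟨fun t => c + G t, ?_, ?_, ?_⟩
  · exact (contDiffOn_const (c := c)).absolutelyContinuousOnInterval.add hac
  · filter_upwards [hc] with t ht h1
    have := ht h1
    simp only [Pi.sub_apply] at this
    linarith
  · filter_upwards [hder] with t ht h1 using (ht h1).const_add c

/-- Second order version of the lemma of du Bois-Reymond. -/
theorem exists_absolutelyContinuous_of_integral_deriv_deriv {A B : ℝ → ℝ}
    (hA : IntegrableOn A (Ioo 0 1)) (hB : IntegrableOn B (Ioo 0 1))
    (h : ∀ φ : ℝ → ℝ, IsTest φ →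
      ∫ t in (0 : ℝ)..1, (deriv (deriv φ) t * A t + deriv φ t * B t) = 0) :
    ∃ (C : ℝ) (F : ℝ → ℝ), AbsolutelyContinuousOnInterval F 0 1 ∧
      (∀ᵐ t, t ∈ Ioo (0 : ℝ) 1 → A t = F t) ∧
      ∀ᵐ t, t ∈ Ioo (0 : ℝ) 1 → HasDerivAt F (B t + C) t := by
  obtain ⟨ψ, hψ, hψ1⟩ := exists_isTest_integral_eq_one
  -- The hypothesis only covers derivatives of test functions. A general test function differs from
  -- one by `(∫ φ) ψ`, so the error is `c ∫ φ`, and the constant `-c` added to `B` absorbs it.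
  set c := ∫ t in (0 : ℝ)..1, (deriv ψ t * A t + ψ t * B t) with hc
  refine ⟨-c, exists_absolutelyContinuous_of_weakDeriv hA (hB.add (by simp)) fun φ hφ => ?_⟩
  obtain ⟨χ, hχ, hd⟩ := hψ.decompose hψ1 hφ
  set e := ∫ s in (0 : ℝ)..1, φ s with he
  have hd' : ∀ t, deriv φ t = deriv (deriv χ) t + e * deriv ψ t := by
    intro t
    rw [funext hd]
    exact ((hχ.deriv.differentiable t).hasDerivAt.add
      ((hψ.differentiable t).hasDerivAt.const_mul e)).deriv
  have hi : ∀ ζ : ℝ → ℝ, IsTest ζ →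
      IntervalIntegrable (fun t => deriv ζ t * A t + ζ t * B t) volume 0 1 := fun ζ hζ =>
    (intervalIntegrable_of_Ioo (hζ.deriv.integrable_mul hA)).add
      (intervalIntegrable_of_Ioo (hζ.integrable_mul hB))
  have hsum : ∫ t in (0 : ℝ)..1, (deriv φ t * A t + φ t * B t) = e * c := by
    have : ∀ t, deriv φ t * A t + φ t * B t
        = (deriv (deriv χ) t * A t + deriv χ t * B t) + e * (deriv ψ t * A t + ψ t * B t) := by
      intro t
      rw [hd' t]
      nth_rewrite 1 [hd t]
      ring
    simp_rw [this]
    rw [intervalIntegral.integral_add (hi _ hχ.deriv) ((hi ψ hψ).const_mul e), h χ hχ,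
      intervalIntegral.integral_const_mul, zero_add]
  have i1 := intervalIntegrable_of_Ioo (hφ.deriv.integrable_mul hA)
  have i2 := intervalIntegrable_of_Ioo (hφ.integrable_mul hB)
  have i3 : IntervalIntegrable φ volume 0 1 := hφ.continuous.intervalIntegrable _ _
  rw [intervalIntegral.integral_add i1 i2] at hsum
  simp only [mul_add]
  rw [intervalIntegral.integral_add i2 (i3.mul_const _), intervalIntegral.integral_mul_const, ← he]
  linarith

/-! ### Plane coordinates and the calculus of absolutely continuous functions. -/

/-- A coordinate of the plane, as a continuous linear functional. -/
def coordCLM (i : Fin 2) : Plane →L[ℝ] ℝ := EuclideanSpace.proj i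

theorem hasDerivWithinAt_plane {f : ℝ → Plane} {u v : ℝ} {s : Set ℝ} {t : ℝ} :
    HasDerivWithinAt f !₂[u, v] s t ↔
      HasDerivWithinAt (fun t => f t 0) u s t ∧ HasDerivWithinAt (fun t => f t 1) v s t := by
  rw [hasDerivWithinAt_iff_hasFDerivWithinAt, hasFDerivWithinAt_euclidean, Fin.forall_fin_two,
    hasDerivWithinAt_iff_hasFDerivWithinAt, hasDerivWithinAt_iff_hasFDerivWithinAt]
  have e : ∀ i (c : ℝ), (!₂[u, v] : Plane) i = c →
      (PiLp.proj (𝕜 := ℝ) 2 (fun _ : Fin 2 => ℝ) i) ∘L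
        (ContinuousLinearMap.toSpanSingleton ℝ (!₂[u, v] : Plane))
        = ContinuousLinearMap.toSpanSingleton ℝ c := by
    intro i c h
    ext
    simpa using h
  rw [← e 0 u rfl, ← e 1 v rfl]

theorem hasDerivAt_plane {f : ℝ → Plane} {u v : ℝ} {t : ℝ} :
    HasDerivAt f !₂[u, v] t ↔
      HasDerivAt (fun t => f t 0) u t ∧ HasDerivAt (fun t => f t 1) v t := by
  simp only [← hasDerivWithinAt_univ, hasDerivWithinAt_plane]

theorem norm_plane (z : Plane) : ‖z‖ = √(z 0 ^ 2 + z 1 ^ 2) := by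
  rw [EuclideanSpace.norm_eq]
  simp [Fin.sum_univ_two]

theorem ae_uIcc_of_ae_Ioo {P : ℝ → Prop} (h : ∀ᵐ t, t ∈ Ioo (0 : ℝ) 1 → P t) :
    ∀ᵐ t, t ∈ uIcc (0 : ℝ) 1 → P t := by
  have h₁ : ∀ᵐ x : ℝ, x ≠ 0 := by simp [ae_iff, measure_singleton]
  have h₂ : ∀ᵐ x : ℝ, x ≠ 1 := by simp [ae_iff, measure_singleton]
  filter_upwards [h, h₁, h₂] with t h h1 h2 h3
  rw [uIcc_of_le zero_le_one] at h3
  exact h ⟨lt_of_le_of_ne h3.1 h1.symm, lt_of_le_of_ne h3.2 h2⟩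

theorem ContinuousOn.exists_continuous_extension {U : ℝ → ℝ} (hU : ContinuousOn U (Icc 0 1)) :
    ∃ V : ℝ → ℝ, Continuous V ∧ EqOn V U (Icc 0 1) :=
  ⟨IccExtend zero_le_one ((Icc (0 : ℝ) 1).domRestrict U),
    (continuousOn_iff_continuous_domRestrict.1 hU).Icc_extend',
    fun _ ht => IccExtend_of_mem zero_le_one ((Icc (0 : ℝ) 1).domRestrict U) ht⟩

theorem AbsolutelyContinuousOnInterval.eqOn_of_ae_hasDerivAt {F G : ℝ → ℝ} {g : ℝ → ℝ}
    (hF : AbsolutelyContinuousOnInterval F 0 1) (hG : AbsolutelyContinuousOnInterval G 0 1)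
    (hF' : ∀ᵐ t, t ∈ Ioo (0 : ℝ) 1 → HasDerivAt F (g t) t)
    (hG' : ∀ᵐ t, t ∈ Ioo (0 : ℝ) 1 → HasDerivAt G (g t) t) :
    ∃ c, ∀ t ∈ Icc (0 : ℝ) 1, F t = G t + c := by
  obtain ⟨c, hc⟩ := (hF.sub hG).const_of_ae_hasDerivAt_zero (by
    refine ae_uIcc_of_ae_Ioo ?_
    filter_upwards [hF', hG'] with t h1 h2 h3
    simpa using (h1 h3).sub (h2 h3))
  refine ⟨c, fun t ht => ?_⟩
  have := hc t (by rwa [uIcc_of_le zero_le_one])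
  simp only [Pi.sub_apply] at this
  linarith

/-- An absolutely continuous function whose almost everywhere derivative is continuous is `C¹`. -/
theorem AbsolutelyContinuousOnInterval.hasDerivWithinAt_of_ae {F U : ℝ → ℝ}
    (hF : AbsolutelyContinuousOnInterval F 0 1) (hU : ContinuousOn U (Icc 0 1))
    (h : ∀ᵐ t, t ∈ Ioo (0 : ℝ) 1 → HasDerivAt F (U t) t) {t : ℝ} (ht : t ∈ Icc (0 : ℝ) 1) :
    HasDerivWithinAt F (U t) (Icc 0 1) t := by
  obtain ⟨V, hV, hVU⟩ := ContinuousOn.exists_continuous_extension hU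
  have hd : ∀ t, HasDerivAt (fun t => ∫ s in (0 : ℝ)..t, V s) (V t) t := fun t =>
    intervalIntegral.integral_hasDerivAt_right (hV.intervalIntegrable _ _)
      (hV.stronglyMeasurableAtFilter _ _) hV.continuousAt
  obtain ⟨c, hc⟩ := eqOn_of_ae_hasDerivAt hF
    ((hV.intervalIntegrable 0 1).absolutelyContinuousOnInterval_intervalIntegral (c := 0) (by simp))
    h (Eventually.of_forall fun t ht => by
      rw [← hVU (Ioo_subset_Icc_self ht)]; exact hd t)
  have := ((hd t).add_const c).hasDerivWithinAt (s := Icc 0 1)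
  rw [hVU ht] at this
  exact this.congr hc (hc t ht)

theorem absolutelyContinuousOnInterval_of_hasDerivWithinAt {F U : ℝ → ℝ}
    (hU : ContinuousOn U (Icc 0 1))
    (h : ∀ t ∈ Icc (0 : ℝ) 1, HasDerivWithinAt F (U t) (Icc 0 1) t) :
    AbsolutelyContinuousOnInterval F 0 1 := by
  have hu : UniqueDiffOn ℝ (Icc (0 : ℝ) 1) := uniqueDiffOn_Icc zero_lt_one
  refine ContDiffOn.absolutelyContinuousOnInterval ?_
  rw [uIcc_of_le zero_le_one, show (1 : WithTop ℕ∞) = 0 + 1 by simp,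
    contDiffOn_succ_iff_derivWithin hu]
  refine ⟨fun t ht => (h t ht).differentiableWithinAt, by simp, ?_⟩
  rw [contDiffOn_zero]
  exact hU.congr fun t ht => (h t ht).derivWithin (hu t ht)

theorem AbsolutelyContinuousOnInterval.comp_contDiffOn {F g : ℝ → ℝ}
    (hF : AbsolutelyContinuousOnInterval F 0 1) {m M : ℝ} (hg : ContDiffOn ℝ 1 g (Icc m M))
    (hm : ∀ t ∈ Icc (0 : ℝ) 1, F t ∈ Icc m M) :
    AbsolutelyContinuousOnInterval (fun t => g (F t)) 0 1 := by
  obtain ⟨K, hK⟩ := hg.exists_lipschitzOnWith one_ne_zero (convex_Icc _ _) isCompact_Icc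
  rw [absolutelyContinuousOnInterval_iff] at hF ⊢
  intro ε hε
  obtain ⟨δ, hδ, h⟩ := hF (ε / (K + 1)) (by positivity)
  refine ⟨δ, hδ, fun E hE hE' => ?_⟩
  have hmem := hE.1
  rw [uIcc_of_le zero_le_one] at hmem
  calc ∑ i ∈ Finset.range E.1, dist (g (F (E.2 i).1)) (g (F (E.2 i).2))
      ≤ ∑ i ∈ Finset.range E.1, K * dist (F (E.2 i).1) (F (E.2 i).2) :=
        Finset.sum_le_sum fun i hi => hK.dist_le_mul _ (hm _ (hmem i hi).1) _ (hm _ (hmem i hi).2)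
    _ = K * ∑ i ∈ Finset.range E.1, dist (F (E.2 i).1) (F (E.2 i).2) := by rw [Finset.mul_sum]
    _ ≤ K * (ε / (K + 1)) := by gcongr; exact (h E hE hE').le
    _ < ε := by
        rw [mul_div_assoc', div_lt_iff₀ (by positivity)]
        nlinarith [K.2]

/-! ### From Sobolev immersions to absolutely continuous velocities. -/

/-- `(u, v)` is the derivative of the curve `γ` on `[0,1]`; it is absolutely continuous with
derivative in `L^p`, and does not vanish. -/
structure IsVelocity (p : ℝ) (γ : ℝ → Plane) (u v : ℝ → ℝ) : Prop where
  ac_fst : AbsolutelyContinuousOnInterval u 0 1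
  ac_snd : AbsolutelyContinuousOnInterval v 0 1
  memLp_fst : MemLp (deriv u) (ENNReal.ofReal p) (volume.restrict (Ioo 0 1))
  memLp_snd : MemLp (deriv v) (ENNReal.ofReal p) (volume.restrict (Ioo 0 1))
  hasDeriv : ∀ t ∈ Icc (0 : ℝ) 1, HasDerivWithinAt γ !₂[u t, v t] (Icc 0 1) t
  pos : ∀ t ∈ Icc (0 : ℝ) 1, 0 < u t ^ 2 + v t ^ 2

theorem MemL.integrableOn_apply {p : ℝ} (hp : 1 ≤ p) {f : ℝ → Plane} (hf : MemL p f) (i : Fin 2) :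
    IntegrableOn (fun t => f t i) (Ioo 0 1) := by
  have h1 : Integrable f (volume.restrict (Ioo (0 : ℝ) 1)) :=
    MemLp.integrable (by simpa using ENNReal.ofReal_le_ofReal hp) hf
  exact (coordCLM i).integrable_comp h1

theorem setIntegral_smul_apply {p : ℝ} (hp : 1 ≤ p) {ψ : ℝ → ℝ} {k : ℝ → Plane} (hψ : IsTest ψ)
    (hk : MemL p k) (i : Fin 2) :
    (∫ t in Ioo (0 : ℝ) 1, ψ t • k t) i = ∫ t in (0 : ℝ)..1, ψ t * k t i := by
  have h1 : Integrable k (volume.restrict (Ioo (0 : ℝ) 1)) :=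
    MemLp.integrable (by simpa using ENNReal.ofReal_le_ofReal hp) hk
  obtain ⟨C, hC⟩ := hψ.bound
  have h2 : Integrable (fun t => ψ t • k t) (volume.restrict (Ioo (0 : ℝ) 1)) :=
    h1.bdd_smul C hψ.continuous.aestronglyMeasurable (Eventually.of_forall hC)
  rw [← setIntegral_Ioo_eq]
  exact ((coordCLM i).integral_comp_comm h2).symm

theorem HasWeakDeriv.apply {p : ℝ} (hp : 1 ≤ p) {f g : ℝ → Plane} (hf : MemL p f) (hg : MemL p g)
    (h : HasWeakDeriv f g) (i : Fin 2) (φ : ℝ → ℝ) (hφ : IsTest φ) :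
    ∫ t in (0 : ℝ)..1, deriv φ t * f t i = -∫ t in (0 : ℝ)..1, φ t * g t i := by
  have := congrArg (fun z : Plane => z i) (h φ hφ)
  rw [PiLp.neg_apply, setIntegral_smul_apply hp hφ.deriv hf,
    setIntegral_smul_apply hp hφ hg] at this
  exact this

/-- Each coordinate of the weak velocity has an absolutely continuous representative `U`. The
coordinate of `γ` agrees almost everywhere with an absolutely continuous `F` having `F' = U` almost
everywhere. Continuity of `γ` upgrades the first agreement to all of `[0,1]`, continuity of `U`
makes `F` continuously differentiable there. -/
theorem IsImmersedW2.exists_isVelocity {p : ℝ} (hp : 1 ≤ p) {γ : ℝ → Plane}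
    (h : IsImmersedW2 p γ) : ∃ u v : ℝ → ℝ, IsVelocity p γ u v := by
  obtain ⟨hγ, V, a, hV, ha, hw1, hw2⟩ := h.memW2
  have main : ∀ i : Fin 2, ∃ U : ℝ → ℝ, AbsolutelyContinuousOnInterval U 0 1 ∧
      MemLp (deriv U) (ENNReal.ofReal p) (volume.restrict (Ioo 0 1)) ∧
      ∀ t ∈ Icc (0 : ℝ) 1, HasDerivWithinAt (fun t => γ t i) (U t) (Icc 0 1) t := by
    intro i
    obtain ⟨F, hF, hγF, hF'⟩ := exists_absolutelyContinuous_of_weakDeriv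
      (hγ.integrableOn_apply hp i) (hV.integrableOn_apply hp i) (hw1.apply hp hγ hV i)
    obtain ⟨U, hU, hVU, hU'⟩ := exists_absolutelyContinuous_of_weakDeriv
      (hV.integrableOn_apply hp i) (ha.integrableOn_apply hp i) (hw2.apply hp hV ha i)
    have hUc := hU.continuousOn
    have hFc := hF.continuousOn
    rw [uIcc_of_le zero_le_one] at hUc hFc
    refine ⟨U, hU, ?_, fun t ht => ?_⟩
    · have h1 : MemLp (fun t => a t i) (ENNReal.ofReal p) (volume.restrict (Ioo 0 1)) :=
        ContinuousLinearMap.comp_memLp' (coordCLM i) ha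
      refine h1.ae_eq ((ae_restrict_iff' measurableSet_Ioo).2 ?_)
      filter_upwards [hU'] with t h1 h2 using (h1 h2).deriv.symm
    · have hFU : ∀ᵐ t, t ∈ Ioo (0 : ℝ) 1 → HasDerivAt F (U t) t := by
        filter_upwards [hF', hVU] with t h1 h2 h3
        rw [← h2 h3]
        exact h1 h3
      have heq : EqOn (fun t => γ t i) F (Icc 0 1) := by
        refine Measure.eqOn_Icc_of_ae_eq volume zero_ne_one ?_ ?_ hFc
        · refine (ae_restrict_iff' measurableSet_Icc).2 ?_
          have := ae_uIcc_of_ae_Ioo hγF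
          rwa [uIcc_of_le zero_le_one] at this
        · exact (coordCLM i).continuous.comp_continuousOn h.continuousOn
      exact (AbsolutelyContinuousOnInterval.hasDerivWithinAt_of_ae hF hUc hFU ht).congr
        (fun s hs => heq hs) (heq ht)
  obtain ⟨u, hu, hu', hud⟩ := main 0
  obtain ⟨v, hv, hv', hvd⟩ := main 1
  have hd : ∀ t ∈ Icc (0 : ℝ) 1, HasDerivWithinAt γ !₂[u t, v t] (Icc 0 1) t := fun t ht =>
    hasDerivWithinAt_plane.2 ⟨hud t ht, hvd t ht⟩
  refine ⟨u, v, hu, hv, hu', hv', hd, fun t ht => ?_⟩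
  have h1 := h.derivWithin_ne_zero t ht
  rw [(hd t ht).derivWithin (uniqueDiffOn_Icc zero_lt_one t ht)] at h1
  by_contra hcon
  have hu0 : u t = 0 := by nlinarith [sq_nonneg (u t), sq_nonneg (v t)]
  have hv0 : v t = 0 := by nlinarith [sq_nonneg (u t), sq_nonneg (v t)]
  refine h1 ?_
  ext i
  fin_cases i <;> simp [hu0, hv0]

/-! ### The energy density, its variation, and growth bounds. -/

/-- The odd power `|k|^{p-2} k`. -/
def oddPow (p k : ℝ) : ℝ := |k| ^ (p - 2) * k

theorem oddPow_mul_self {p : ℝ} (hp : p ≠ 0) (k : ℝ) : oddPow p k * k = |k| ^ p := by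
  rcases eq_or_ne k 0 with rfl | hk
  · simp [oddPow, Real.zero_rpow hp]
  · have h := abs_pos.2 hk
    rw [oddPow, mul_assoc, ← abs_mul_abs_self k, ← sq, ← Real.rpow_natCast, ← Real.rpow_add h]
    norm_num

theorem abs_oddPow {p : ℝ} (hp : p ≠ 1) (k : ℝ) : |oddPow p k| = |k| ^ (p - 1) := by
  rcases eq_or_ne k 0 with rfl | hk
  · simp [oddPow, Real.zero_rpow (sub_ne_zero.2 hp)]
  · have h := abs_pos.2 hk
    rw [oddPow, abs_mul, abs_of_nonneg (Real.rpow_nonneg h.le _)]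
    nth_rewrite 2 [← Real.rpow_one |k|]
    rw [← Real.rpow_add h]
    ring_nf

theorem hasDerivAt_abs_rpow' {p : ℝ} (hp : 1 < p) (k : ℝ) :
    HasDerivAt (fun x : ℝ => |x| ^ p) (p * oddPow p k) k := by
  have := hasDerivAt_abs_rpow k hp
  rwa [mul_assoc] at this

/-- The curvature of a curve with velocity `(u, v)` and acceleration `(a, b)`. -/
def kappa (u v a b : ℝ) : ℝ := (u * b - v * a) / √(u ^ 2 + v ^ 2) ^ 3

/-- The density `(c |k|^p + d) ds`. -/
def density (c d p u v a b : ℝ) : ℝ := (c * |kappa u v a b| ^ p + d) * √(u ^ 2 + v ^ 2)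

/-- The derivative of `kappa` in the direction `(α, β, α', β')`. -/
def kappaVar (u v a b α β α' β' : ℝ) : ℝ :=
  (α * b + u * β' - β * a - v * α') / √(u ^ 2 + v ^ 2) ^ 3
    - 3 * kappa u v a b * (u * α + v * β) / √(u ^ 2 + v ^ 2) ^ 2

/-- The derivative of `density` in the direction `(α, β, α', β')`. -/
def densityVar (c d p u v a b α β α' β' : ℝ) : ℝ :=
  c * (p * oddPow p (kappa u v a b) * kappaVar u v a b α β α' β') * √(u ^ 2 + v ^ 2)
    + (c * |kappa u v a b| ^ p + d) * ((u * α + v * β) / √(u ^ 2 + v ^ 2))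

theorem hasDerivAt_density {c d p : ℝ} (hp : 1 < p) {u v a b α β α' β' ε : ℝ}
    (hq : 0 < (u + ε * α) ^ 2 + (v + ε * β) ^ 2) :
    HasDerivAt (fun ε => density c d p (u + ε * α) (v + ε * β) (a + ε * α') (b + ε * β'))
      (densityVar c d p (u + ε * α) (v + ε * β) (a + ε * α') (b + ε * β') α β α' β') ε := by
  have lin : ∀ x y : ℝ, HasDerivAt (fun ε : ℝ => x + ε * y) y ε := fun x y => by
    simpa using ((hasDerivAt_id ε).mul_const y).const_add x
  have hr := Real.sqrt_pos.2 hq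
  have hs : HasDerivAt (fun ε => √((u + ε * α) ^ 2 + (v + ε * β) ^ 2))
      (((u + ε * α) * α + (v + ε * β) * β) / √((u + ε * α) ^ 2 + (v + ε * β) ^ 2)) ε := by
    refine ((((lin u α).pow 2).add ((lin v β).pow 2)).sqrt hq.ne').congr_deriv ?_
    simp only [Pi.add_apply, Pi.pow_apply]
    field_simp
    ring
  have hk : HasDerivAt (fun ε => kappa (u + ε * α) (v + ε * β) (a + ε * α') (b + ε * β'))
      (kappaVar (u + ε * α) (v + ε * β) (a + ε * α') (b + ε * β') α β α' β') ε := by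
    refine ((((lin u α).mul (lin b β')).sub ((lin v β).mul (lin a α'))).div (hs.pow 3)
      (pow_ne_zero 3 hr.ne')).congr_deriv ?_
    simp only [kappaVar, kappa, Pi.mul_apply, Pi.pow_apply, Pi.sub_apply]
    generalize √((u + ε * α) ^ 2 + (v + ε * β) ^ 2) = r at hr
    field_simp
    ring
  have h1 := (((hasDerivAt_abs_rpow' hp _).comp ε hk).const_mul c).add_const d
  exact h1.mul hs

/-- All growth bounds are in terms of `S = |a| + |b| + 1`. The summand `1` gives `S ≥ 1`, so lower
order terms are absorbed into `S ^ p`, which is integrable because the acceleration is in `L^p`. -/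
theorem abs_kappa_le {u v a b m : ℝ} (hm : 0 < m) (h : m ≤ √(u ^ 2 + v ^ 2)) :
    |kappa u v a b| ≤ (m ^ 2)⁻¹ * (|a| + |b| + 1) := by
  set r := √(u ^ 2 + v ^ 2) with hr
  have hr0 : 0 < r := hm.trans_le h
  have hu : |u| ≤ r := Real.abs_le_sqrt (by nlinarith [sq_nonneg v])
  have hv : |v| ≤ r := Real.abs_le_sqrt (by nlinarith [sq_nonneg u])
  rw [kappa, ← hr, abs_div, abs_of_pos (pow_pos hr0 3), div_le_iff₀ (pow_pos hr0 3)]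
  have h1 : |u * b - v * a| ≤ r * (|a| + |b| + 1) := by
    calc |u * b - v * a| ≤ |u * b| + |v * a| := abs_sub _ _
      _ = |u| * |b| + |v| * |a| := by rw [abs_mul, abs_mul]
      _ ≤ r * |b| + r * |a| := by gcongr
      _ ≤ r * (|a| + |b| + 1) := by nlinarith
  refine h1.trans ?_
  have h2 : 1 ≤ (m ^ 2)⁻¹ * r ^ 2 := by
    rw [inv_mul_eq_div, one_le_div (by positivity)]
    gcongr
  have h3 : 0 ≤ r * (|a| + |b| + 1) := by positivity
  nlinarith [mul_le_mul_of_nonneg_left h2 h3]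

/-- The constant in the bounds for the powers of the curvature. -/
def kappaConst (p m : ℝ) : ℝ := (m ^ 2)⁻¹ ^ p + (m ^ 2)⁻¹ ^ (p - 1)

theorem kappaConst_nonneg (p m : ℝ) : 0 ≤ kappaConst p m := by
  unfold kappaConst; positivity

theorem abs_kappa_rpow_le {p u v a b m : ℝ} (hp : 1 < p) (hm : 0 < m)
    (h : m ≤ √(u ^ 2 + v ^ 2)) :
    |kappa u v a b| ^ p ≤ kappaConst p m * (|a| + |b| + 1) ^ p := by
  calc |kappa u v a b| ^ p ≤ ((m ^ 2)⁻¹ * (|a| + |b| + 1)) ^ p :=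
        Real.rpow_le_rpow (abs_nonneg _) (abs_kappa_le hm h) (by linarith)
    _ = (m ^ 2)⁻¹ ^ p * (|a| + |b| + 1) ^ p := Real.mul_rpow (by positivity) (by positivity)
    _ ≤ _ := by
      gcongr
      unfold kappaConst
      have : 0 ≤ (m ^ 2)⁻¹ ^ (p - 1) := by positivity
      linarith

theorem abs_oddPow_kappa_le {p u v a b m : ℝ} (hp : 1 < p) (hm : 0 < m)
    (h : m ≤ √(u ^ 2 + v ^ 2)) :
    |oddPow p (kappa u v a b)| * (|a| + |b| + 1) ≤ kappaConst p m * (|a| + |b| + 1) ^ p := by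
  have hS : 0 < |a| + |b| + 1 := by positivity
  rw [abs_oddPow hp.ne']
  calc |kappa u v a b| ^ (p - 1) * (|a| + |b| + 1)
      ≤ ((m ^ 2)⁻¹ * (|a| + |b| + 1)) ^ (p - 1) * (|a| + |b| + 1) := by
        gcongr
        exact abs_kappa_le hm h
    _ = (m ^ 2)⁻¹ ^ (p - 1) * ((|a| + |b| + 1) ^ (p - 1) * (|a| + |b| + 1)) := by
        rw [Real.mul_rpow (by positivity) (by positivity), mul_assoc]
    _ = (m ^ 2)⁻¹ ^ (p - 1) * (|a| + |b| + 1) ^ p := by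
        rw [← Real.rpow_add_one hS.ne']; ring_nf
    _ ≤ _ := by
      gcongr
      unfold kappaConst
      have : 0 ≤ (m ^ 2)⁻¹ ^ p := by positivity
      linarith

theorem one_le_rpow_sum {p a b : ℝ} (hp : 1 < p) : 1 ≤ (|a| + |b| + 1) ^ p :=
  Real.one_le_rpow (by linarith [abs_nonneg a, abs_nonneg b]) (by linarith)

theorem abs_density_le {c d p u v a b m M : ℝ} (hp : 1 < p) (hm : 0 < m)
    (h : m ≤ √(u ^ 2 + v ^ 2)) (hM : √(u ^ 2 + v ^ 2) ≤ M) :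
    |density c d p u v a b| ≤ (|c| * kappaConst p m + |d|) * M * (|a| + |b| + 1) ^ p := by
  have h1 := abs_kappa_rpow_le (a := a) (b := b) hp hm h
  have h2 := one_le_rpow_sum (a := a) (b := b) hp
  have h3 := abs_nonneg c
  have h4 := abs_nonneg d
  have h5 : 0 ≤ |kappa u v a b| ^ p := by positivity
  have h6 : 0 ≤ M := (Real.sqrt_nonneg _).trans hM
  rw [density, abs_mul, abs_of_nonneg (Real.sqrt_nonneg _)]
  calc |c * |kappa u v a b| ^ p + d| * √(u ^ 2 + v ^ 2)
      ≤ (|c| * |kappa u v a b| ^ p + |d|) * M := by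
        gcongr
        refine (abs_add_le _ _).trans ?_
        rw [abs_mul, abs_of_nonneg h5]
    _ ≤ (|c| * (kappaConst p m * (|a| + |b| + 1) ^ p) + |d| * (|a| + |b| + 1) ^ p) * M := by
        gcongr
        exact le_mul_of_one_le_right h4 h2
    _ = _ := by ring

theorem abs_dot_div_le {u v α β r N : ℝ} (hr : 0 < r) (hu : |u| ≤ r) (hv : |v| ≤ r)
    (hα : |α| ≤ N) (hβ : |β| ≤ N) : |(u * α + v * β) / r| ≤ 2 * N := by
  have hN : 0 ≤ N := (abs_nonneg α).trans hα
  rw [abs_div, abs_of_pos hr, div_le_iff₀ hr]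
  calc |u * α + v * β| ≤ |u| * |α| + |v| * |β| := by
        rw [← abs_mul, ← abs_mul]; exact abs_add_le _ _
    _ ≤ r * N + r * N := by gcongr
    _ = 2 * N * r := by ring

theorem abs_kappaVar_le {u v a b α β α' β' m N : ℝ} (hm : 0 < m) (h : m ≤ √(u ^ 2 + v ^ 2))
    (hα : |α| ≤ N) (hβ : |β| ≤ N) (hα' : |α'| ≤ N) (hβ' : |β'| ≤ N) :
    |kappaVar u v a b α β α' β'| ≤
      (N / m ^ 3 + 2 * N / m ^ 2 + 3 * (m ^ 2)⁻¹ * (2 * N) / m) * (|a| + |b| + 1) := by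
  have hk := abs_kappa_le (a := a) (b := b) hm h
  have hN : 0 ≤ N := (abs_nonneg α).trans hα
  unfold kappaVar
  set r := √(u ^ 2 + v ^ 2) with hr
  set S := |a| + |b| + 1 with hS
  have hS1 : 1 ≤ S := by linarith [abs_nonneg a, abs_nonneg b]
  have hr0 : 0 < r := hm.trans_le h
  have hu : |u| ≤ r := Real.abs_le_sqrt (by nlinarith [sq_nonneg v])
  have hv : |v| ≤ r := Real.abs_le_sqrt (by nlinarith [sq_nonneg u])
  have h1 : |(α * b - β * a) / r ^ 3| ≤ N / m ^ 3 * S := by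
    rw [abs_div, abs_of_pos (pow_pos hr0 3)]
    calc |α * b - β * a| / r ^ 3 ≤ (|α| * |b| + |β| * |a|) / m ^ 3 := by
          rw [← abs_mul, ← abs_mul]
          gcongr
          exact abs_sub _ _
      _ ≤ (N * |b| + N * |a|) / m ^ 3 := by gcongr
      _ ≤ (N * S) / m ^ 3 := by
          gcongr
          nlinarith
      _ = _ := by ring
  have h2 : |(u * β' - v * α') / r ^ 3| ≤ 2 * N / m ^ 2 * S := by
    have : (u * β' - v * α') / r ^ 3 = ((u * β' + v * (-α')) / r) / r ^ 2 := by
      field_simp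
      ring
    rw [this, abs_div, abs_of_pos (pow_pos hr0 2)]
    calc |(u * β' + v * (-α')) / r| / r ^ 2 ≤ 2 * N / m ^ 2 := by
          gcongr
          exact abs_dot_div_le hr0 hu hv hβ' (by rwa [abs_neg])
      _ ≤ 2 * N / m ^ 2 * S := le_mul_of_one_le_right (by positivity) hS1
  have h3 : |3 * kappa u v a b * (u * α + v * β) / r ^ 2|
      ≤ 3 * (m ^ 2)⁻¹ * (2 * N) / m * S := by
    have : 3 * kappa u v a b * (u * α + v * β) / r ^ 2
        = 3 * kappa u v a b * ((u * α + v * β) / r) / r := by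
      field_simp
    rw [this, abs_div, abs_mul, abs_mul, abs_of_pos hr0, abs_of_pos (three_pos (α := ℝ))]
    calc 3 * |kappa u v a b| * |(u * α + v * β) / r| / r
        ≤ 3 * ((m ^ 2)⁻¹ * S) * (2 * N) / m := by
          gcongr
          exact abs_dot_div_le hr0 hu hv hα hβ
      _ = _ := by ring
  have h4 : (α * b + u * β' - β * a - v * α') / r ^ 3
      = (α * b - β * a) / r ^ 3 + (u * β' - v * α') / r ^ 3 := by ring
  rw [h4]
  calc _ ≤ |(α * b - β * a) / r ^ 3 + (u * β' - v * α') / r ^ 3|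
        + |3 * kappa u v a b * (u * α + v * β) / r ^ 2| := abs_sub _ _
    _ ≤ |(α * b - β * a) / r ^ 3| + |(u * β' - v * α') / r ^ 3|
        + |3 * kappa u v a b * (u * α + v * β) / r ^ 2| := by
        gcongr; exact abs_add_le _ _
    _ ≤ _ := by linarith

/-- The varied curvature grows linearly in `S` and is multiplied by `|k|^{p-1}`, so the total growth
is again `S ^ p`. The constant is uniform in the velocity as long as the speed stays in `[m, M]`, as
domination requires. -/
theorem exists_abs_densityVar_le (c d : ℝ) {p m M N : ℝ} (hp : 1 < p) (hm : 0 < m) :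
    ∃ C, 0 ≤ C ∧ ∀ u v a b α β α' β' : ℝ, m ≤ √(u ^ 2 + v ^ 2) → √(u ^ 2 + v ^ 2) ≤ M →
      |α| ≤ N → |β| ≤ N → |α'| ≤ N → |β'| ≤ N →
      |densityVar c d p u v a b α β α' β'| ≤ C * (|a| + |b| + 1) ^ p := by
  set E := N / m ^ 3 + 2 * N / m ^ 2 + 3 * (m ^ 2)⁻¹ * (2 * N) / m with hE
  refine ⟨|(|c| * p * E * kappaConst p m * M + (|c| * kappaConst p m + |d|) * (2 * N))|,
    abs_nonneg _, fun u v a b α β α' β' h hM hα hβ hα' hβ' => ?_⟩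
  have hN : 0 ≤ N := (abs_nonneg α).trans hα
  have hE0 : 0 ≤ E := by rw [hE]; positivity
  have h1 := abs_kappa_rpow_le (a := a) (b := b) hp hm h
  have h1' := abs_oddPow_kappa_le (a := a) (b := b) hp hm h
  have h2 := one_le_rpow_sum (a := a) (b := b) hp
  have h3 := abs_nonneg c
  have h4 := abs_nonneg d
  have h5 : 0 ≤ |kappa u v a b| ^ p := by positivity
  have h6 : 0 ≤ M := (Real.sqrt_nonneg _).trans hM
  have h7 := abs_kappaVar_le (a := a) (b := b) hm h hα hβ hα' hβ'
  rw [← hE] at h7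
  unfold densityVar
  set r := √(u ^ 2 + v ^ 2) with hr
  set S := |a| + |b| + 1 with hS
  have hr0 : 0 < r := hm.trans_le h
  have hu : |u| ≤ r := Real.abs_le_sqrt (by nlinarith [sq_nonneg v])
  have hv : |v| ≤ r := Real.abs_le_sqrt (by nlinarith [sq_nonneg u])
  have h8 := abs_dot_div_le hr0 hu hv hα hβ
  refine (abs_add_le _ _).trans (le_trans ?_
    (mul_le_mul_of_nonneg_right (le_abs_self _) (by positivity)))
  have e1 : |c * (p * oddPow p (kappa u v a b) * kappaVar u v a b α β α' β') * r|
      ≤ |c| * p * E * kappaConst p m * M * S ^ p := by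
    rw [abs_mul, abs_mul, abs_mul, abs_mul, abs_of_pos hr0, abs_of_pos (by linarith : 0 < p)]
    calc |c| * (p * |oddPow p (kappa u v a b)| * |kappaVar u v a b α β α' β'|) * r
        ≤ |c| * (p * |oddPow p (kappa u v a b)| * (E * S)) * M := by gcongr
      _ = |c| * p * E * (|oddPow p (kappa u v a b)| * S) * M := by ring
      _ ≤ |c| * p * E * (kappaConst p m * S ^ p) * M := by gcongr
      _ = _ := by ring
  have e2 : |(c * |kappa u v a b| ^ p + d) * ((u * α + v * β) / r)|
      ≤ (|c| * kappaConst p m + |d|) * (2 * N) * S ^ p := by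
    rw [abs_mul]
    calc _ ≤ (|c| * |kappa u v a b| ^ p + |d|) * (2 * N) := by
          gcongr
          refine (abs_add_le _ _).trans ?_
          rw [abs_mul, abs_of_nonneg h5]
      _ ≤ (|c| * (kappaConst p m * S ^ p) + |d| * S ^ p) * (2 * N) := by
          gcongr
          exact le_mul_of_one_le_right h4 h2
      _ = _ := by ring
  calc _ ≤ _ := add_le_add e1 e2
    _ = _ := by ring

/-! ### Differentiating bending energy and length under the integral sign. -/

theorem IsTest.apply {η : ℝ → Plane} (hη : IsTest η) (i : Fin 2) : IsTest (fun t => η t i) := by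
  have h : (fun t => η t i) = coordCLM i ∘ η := rfl
  refine ⟨h ▸ (coordCLM i).contDiff.comp hη.1, ?_, ?_⟩
  · exact hη.2.1.comp_left (g := fun z : Plane => z i) rfl
  · refine Subset.trans (closure_mono fun t ht => ?_) hη.2.2
    intro h0
    exact ht (by simp [h0])

namespace IsVelocity

variable {p : ℝ} {γ : ℝ → Plane} {u v : ℝ → ℝ}

theorem continuousOn_fst (h : IsVelocity p γ u v) : ContinuousOn u (Icc 0 1) := by
  have := h.ac_fst.continuousOn
  rwa [uIcc_of_le zero_le_one] at this

theorem continuousOn_snd (h : IsVelocity p γ u v) : ContinuousOn v (Icc 0 1) := by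
  have := h.ac_snd.continuousOn
  rwa [uIcc_of_le zero_le_one] at this

theorem exists_bounds (h : IsVelocity p γ u v) :
    ∃ m N : ℝ, 0 < m ∧ ∀ t ∈ Icc (0 : ℝ) 1, m ≤ u t ^ 2 + v t ^ 2 ∧ |u t| ≤ N ∧ |v t| ≤ N := by
  have hc : ContinuousOn (fun t => u t ^ 2 + v t ^ 2) (Icc 0 1) :=
    (h.continuousOn_fst.pow 2).add (h.continuousOn_snd.pow 2)
  obtain ⟨t₀, ht₀, hmin⟩ := isCompact_Icc.exists_isMinOn (nonempty_Icc.2 zero_le_one) hc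
  obtain ⟨N₁, hN₁⟩ := isCompact_Icc.exists_bound_of_continuousOn h.continuousOn_fst
  obtain ⟨N₂, hN₂⟩ := isCompact_Icc.exists_bound_of_continuousOn h.continuousOn_snd
  exact ⟨_, max N₁ N₂, h.pos t₀ ht₀, fun t ht => ⟨hmin ht, (hN₁ t ht).trans (le_max_left _ _),
    (hN₂ t ht).trans (le_max_right _ _)⟩⟩

theorem aemeasurable_fst (h : IsVelocity p γ u v) :
    AEMeasurable u (volume.restrict (Ioo (0 : ℝ) 1)) :=
  (h.continuousOn_fst.mono Ioo_subset_Icc_self).aemeasurable measurableSet_Ioo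

theorem aemeasurable_snd (h : IsVelocity p γ u v) :
    AEMeasurable v (volume.restrict (Ioo (0 : ℝ) 1)) :=
  (h.continuousOn_snd.mono Ioo_subset_Icc_self).aemeasurable measurableSet_Ioo

theorem integrable_sum_rpow (h : IsVelocity p γ u v) (hp : 1 < p) :
    Integrable (fun t => (|deriv u t| + |deriv v t| + 1) ^ p) (volume.restrict (Ioo (0 : ℝ) 1)) := by
  have h1 : MemLp (fun t => |deriv u t| + |deriv v t| + 1) (ENNReal.ofReal p)
      (volume.restrict (Ioo (0 : ℝ) 1)) :=
    (h.memLp_fst.abs.add h.memLp_snd.abs).add (memLp_const 1)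
  have h2 := h1.integrable_norm_rpow (by simp; linarith) (by simp)
  refine h2.congr (Eventually.of_forall fun t => ?_)
  simp only [ENNReal.toReal_ofReal (by linarith : 0 ≤ p), Real.norm_eq_abs]
  rw [abs_of_nonneg (by positivity)]

theorem ae_differentiable (h : IsVelocity p γ u v) :
    ∀ᵐ t ∂(volume.restrict (Ioo (0 : ℝ) 1)),
      t ∈ Ioo (0 : ℝ) 1 ∧ DifferentiableAt ℝ u t ∧ DifferentiableAt ℝ v t := by
  rw [ae_restrict_iff' measurableSet_Ioo]
  filter_upwards [h.ac_fst.ae_differentiableAt, h.ac_snd.ae_differentiableAt] with t h1 h2 ht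
  have ht' : t ∈ uIcc (0 : ℝ) 1 := by
    rw [uIcc_of_le zero_le_one]; exact Ioo_subset_Icc_self ht
  exact ⟨ht, h1 ht', h2 ht'⟩

theorem deriv_add_smul (h : IsVelocity p γ u v) {η : ℝ → Plane} (hη : IsTest η) (ε : ℝ) {t : ℝ}
    (ht : t ∈ Ioo (0 : ℝ) 1) :
    deriv (fun t => γ t + ε • η t) t
      = !₂[u t + ε * deriv (fun t => η t 0) t, v t + ε * deriv (fun t => η t 1) t] := by
  have h1 := hasDerivAt_plane.1
    ((h.hasDeriv t (Ioo_subset_Icc_self ht)).hasDerivAt (Icc_mem_nhds ht.1 ht.2))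
  refine (hasDerivAt_plane.2 ⟨?_, ?_⟩).deriv
  · exact h1.1.add (((hη.apply 0).differentiable t).hasDerivAt.const_mul ε)
  · exact h1.2.add (((hη.apply 1).differentiable t).hasDerivAt.const_mul ε)

theorem norm_deriv_add_smul (h : IsVelocity p γ u v) {η : ℝ → Plane} (hη : IsTest η) (ε : ℝ)
    {t : ℝ} (ht : t ∈ Ioo (0 : ℝ) 1) :
    ‖deriv (fun t => γ t + ε • η t) t‖
      = √((u t + ε * deriv (fun t => η t 0) t) ^ 2 + (v t + ε * deriv (fun t => η t 1) t) ^ 2) := by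
  rw [h.deriv_add_smul hη ε ht, norm_plane]
  rfl

theorem curvature_add_smul (h : IsVelocity p γ u v) {η : ℝ → Plane} (hη : IsTest η) (ε : ℝ)
    {t : ℝ} (ht : t ∈ Ioo (0 : ℝ) 1) (hu : DifferentiableAt ℝ u t) (hv : DifferentiableAt ℝ v t) :
    curvature (fun t => γ t + ε • η t) t
      = kappa (u t + ε * deriv (fun t => η t 0) t) (v t + ε * deriv (fun t => η t 1) t)
        (deriv u t + ε * deriv (deriv fun t => η t 0) t)
        (deriv v t + ε * deriv (deriv fun t => η t 1) t) := by
  have h1 : deriv (deriv (fun t => γ t + ε • η t)) t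
      = !₂[deriv u t + ε * deriv (deriv fun t => η t 0) t,
          deriv v t + ε * deriv (deriv fun t => η t 1) t] := by
    have h2 : deriv (fun t => γ t + ε • η t) =ᶠ[𝓝 t] fun t => !₂[u t + ε * deriv (fun t => η t 0) t,
        v t + ε * deriv (fun t => η t 1) t] := by
      filter_upwards [isOpen_Ioo.mem_nhds ht] with s hs using h.deriv_add_smul hη ε hs
    rw [h2.deriv_eq]
    refine (hasDerivAt_plane.2 ⟨?_, ?_⟩).deriv
    · exact hu.hasDerivAt.add (((hη.apply 0).deriv.differentiable t).hasDerivAt.const_mul ε)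
    · exact hv.hasDerivAt.add (((hη.apply 1).deriv.differentiable t).hasDerivAt.const_mul ε)
  rw [curvature, h.norm_deriv_add_smul hη ε ht, h.deriv_add_smul hη ε ht, h1]
  rfl

theorem bendingEnergy_add_smul (h : IsVelocity p γ u v) {η : ℝ → Plane} (hη : IsTest η) (ε : ℝ) :
    bendingEnergy p (fun t => γ t + ε • η t)
      = ∫ t in Ioo (0 : ℝ) 1, density 1 0 p (u t + ε * deriv (fun t => η t 0) t)
        (v t + ε * deriv (fun t => η t 1) t) (deriv u t + ε * deriv (deriv fun t => η t 0) t)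
        (deriv v t + ε * deriv (deriv fun t => η t 1) t) := by
  refine integral_congr_ae ?_
  filter_upwards [h.ae_differentiable] with t ht
  rw [h.norm_deriv_add_smul hη ε ht.1, h.curvature_add_smul hη ε ht.1 ht.2.1 ht.2.2, density,
    one_mul, add_zero]

theorem length_add_smul (h : IsVelocity p γ u v) {η : ℝ → Plane} (hη : IsTest η) (ε : ℝ) :
    length (fun t => γ t + ε • η t)
      = ∫ t in Ioo (0 : ℝ) 1, density 0 1 p (u t + ε * deriv (fun t => η t 0) t)
        (v t + ε * deriv (fun t => η t 1) t) (deriv u t + ε * deriv (deriv fun t => η t 0) t)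
        (deriv v t + ε * deriv (deriv fun t => η t 1) t) := by
  rw [length, arclength, ← setIntegral_Ioo_eq]
  refine setIntegral_congr_fun measurableSet_Ioo fun t ht => ?_
  simp only
  rw [h.norm_deriv_add_smul hη ε ht, density, zero_mul, zero_add, one_mul]

/-- Below, the two cross terms cost at most `4 |ε| N² ≤ m/2`; above, each component is at most `2N`
in absolute value, whence `8 N²`. -/
theorem sqrt_bounds {u v α β ε m N : ℝ} (hN : 1 ≤ N) (hq : m ≤ u ^ 2 + v ^ 2)
    (hu : |u| ≤ N) (hv : |v| ≤ N) (hα : |α| ≤ N) (hβ : |β| ≤ N) (hε1 : |ε| ≤ 1)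
    (hε : |ε| * (8 * N ^ 2) ≤ m) :
    √(m / 2) ≤ √((u + ε * α) ^ 2 + (v + ε * β) ^ 2) ∧
      √((u + ε * α) ^ 2 + (v + ε * β) ^ 2) ≤ √(8 * N ^ 2) := by
  have hε0 := abs_nonneg ε
  have hN0 : 0 ≤ N := by linarith
  have prod : ∀ x y : ℝ, |x| ≤ N → |y| ≤ N → |ε * (x * y)| ≤ |ε| * N ^ 2 := by
    intro x y hx hy
    rw [abs_mul, abs_mul, sq]
    gcongr
  have side : ∀ x y : ℝ, |x| ≤ N → |y| ≤ N → (x + ε * y) ^ 2 ≤ 4 * N ^ 2 := by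
    intro x y hx hy
    have : |x + ε * y| ≤ 2 * N := by
      refine (abs_add_le _ _).trans ?_
      rw [abs_mul]
      nlinarith [abs_nonneg y]
    calc (x + ε * y) ^ 2 = |x + ε * y| ^ 2 := (sq_abs _).symm
      _ ≤ (2 * N) ^ 2 := by gcongr
      _ = 4 * N ^ 2 := by ring
  constructor
  · refine Real.sqrt_le_sqrt ?_
    have h1 := (abs_le.1 (prod u α hu hα)).1
    have h2 := (abs_le.1 (prod v β hv hβ)).1
    nlinarith [sq_nonneg (ε * α), sq_nonneg (ε * β)]
  · refine Real.sqrt_le_sqrt ?_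
    linarith [side u α hu hα, side v β hv hβ]

theorem hasDerivAt_integral_density (h : IsVelocity p γ u v) (hp : 1 < p) (c d : ℝ)
    {α β : ℝ → ℝ} (hα : IsTest α) (hβ : IsTest β) :
    Integrable (fun t => densityVar c d p (u t) (v t) (deriv u t) (deriv v t) (deriv α t)
      (deriv β t) (deriv (deriv α) t) (deriv (deriv β) t)) (volume.restrict (Ioo (0 : ℝ) 1)) ∧
    HasDerivAt (fun ε => ∫ t in Ioo (0 : ℝ) 1, density c d p (u t + ε * deriv α t)
        (v t + ε * deriv β t) (deriv u t + ε * deriv (deriv α) t)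
        (deriv v t + ε * deriv (deriv β) t))
      (∫ t in Ioo (0 : ℝ) 1, densityVar c d p (u t) (v t) (deriv u t) (deriv v t) (deriv α t)
        (deriv β t) (deriv (deriv α) t) (deriv (deriv β) t)) 0 := by
  obtain ⟨m, N₀, hm, hb⟩ := h.exists_bounds
  obtain ⟨N₁, hN₁⟩ := hα.deriv.bound
  obtain ⟨N₂, hN₂⟩ := hβ.deriv.bound
  obtain ⟨N₃, hN₃⟩ := hα.deriv.deriv.bound
  obtain ⟨N₄, hN₄⟩ := hβ.deriv.deriv.bound
  obtain ⟨N, h0, h1, h2, h3, h4, hN⟩ : ∃ N, N₀ ≤ N ∧ N₁ ≤ N ∧ N₂ ≤ N ∧ N₃ ≤ N ∧ N₄ ≤ N ∧ 1 ≤ N :=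
    ⟨max N₀ (max N₁ (max N₂ (max N₃ (max N₄ 1)))), by simp, by simp, by simp, by simp, by simp,
      by simp⟩
  have hN0 : 0 < N := by linarith
  have bα : ∀ t, |deriv α t| ≤ N := fun t => (hN₁ t).trans h1
  have bβ : ∀ t, |deriv β t| ≤ N := fun t => (hN₂ t).trans h2
  have bα' : ∀ t, |deriv (deriv α) t| ≤ N := fun t => (hN₃ t).trans h3
  have bβ' : ∀ t, |deriv (deriv β) t| ≤ N := fun t => (hN₄ t).trans h4
  have hm2 : 0 < √(m / 2) := Real.sqrt_pos.2 (by linarith)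
  obtain ⟨C, hC0, hC⟩ := exists_abs_densityVar_le c d (p := p) (m := √(m / 2)) (M := √(8 * N ^ 2))
    (N := N) hp hm2
  set δ := min 1 (m / (8 * N ^ 2)) with hδ
  have hδ0 : 0 < δ := lt_min one_pos (by positivity)
  have hball : ∀ ε ∈ Metric.ball (0 : ℝ) δ, |ε| ≤ 1 ∧ |ε| * (8 * N ^ 2) ≤ m := by
    intro ε hε
    rw [mem_ball_zero_iff, Real.norm_eq_abs] at hε
    refine ⟨hε.le.trans (min_le_left _ _), ?_⟩
    rw [← le_div_iff₀ (by positivity)]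
    exact hε.le.trans (min_le_right _ _)
  have hbounds : ∀ ε ∈ Metric.ball (0 : ℝ) δ, ∀ t ∈ Ioo (0 : ℝ) 1,
      √(m / 2) ≤ √((u t + ε * deriv α t) ^ 2 + (v t + ε * deriv β t) ^ 2) ∧
      √((u t + ε * deriv α t) ^ 2 + (v t + ε * deriv β t) ^ 2) ≤ √(8 * N ^ 2) := by
    intro ε hε t ht
    obtain ⟨b1, b2, b3⟩ := hb t (Ioo_subset_Icc_self ht)
    exact sqrt_bounds hN b1 (b2.trans h0) (b3.trans h0) (bα t) (bβ t) (hball ε hε).1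
      (hball ε hε).2
  have mu := h.aemeasurable_fst
  have mv := h.aemeasurable_snd
  have mu' : AEMeasurable (deriv u) (volume.restrict (Ioo (0 : ℝ) 1)) :=
    (measurable_deriv u).aemeasurable
  have mv' : AEMeasurable (deriv v) (volume.restrict (Ioo (0 : ℝ) 1)) :=
    (measurable_deriv v).aemeasurable
  have mα : AEMeasurable (deriv α) (volume.restrict (Ioo (0 : ℝ) 1)) :=
    (measurable_deriv _).aemeasurable
  have mβ : AEMeasurable (deriv β) (volume.restrict (Ioo (0 : ℝ) 1)) :=
    (measurable_deriv _).aemeasurable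
  have mα' : AEMeasurable (deriv (deriv α)) (volume.restrict (Ioo (0 : ℝ) 1)) :=
    (measurable_deriv _).aemeasurable
  have mβ' : AEMeasurable (deriv (deriv β)) (volume.restrict (Ioo (0 : ℝ) 1)) :=
    (measurable_deriv _).aemeasurable
  have hmeas : ∀ ε : ℝ, AEStronglyMeasurable (fun t => density c d p (u t + ε * deriv α t)
        (v t + ε * deriv β t) (deriv u t + ε * deriv (deriv α) t)
        (deriv v t + ε * deriv (deriv β) t)) (volume.restrict (Ioo (0 : ℝ) 1)) := by
    intro ε
    refine AEMeasurable.aestronglyMeasurable ?_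
    simp only [density, kappa, ← Real.norm_eq_abs]
    fun_prop
  have hS := h.integrable_sum_rpow hp
  have hzero : (0 : ℝ) ∈ Metric.ball (0 : ℝ) δ := Metric.mem_ball_self hδ0
  have key := hasDerivAt_integral_of_dominated_loc_of_deriv_le
    (μ := volume.restrict (Ioo (0 : ℝ) 1)) (x₀ := (0 : ℝ))
    (F := fun ε t => density c d p (u t + ε * deriv α t)
        (v t + ε * deriv β t) (deriv u t + ε * deriv (deriv α) t)
        (deriv v t + ε * deriv (deriv β) t))
    (F' := fun ε t => densityVar c d p (u t + ε * deriv α t)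
        (v t + ε * deriv β t) (deriv u t + ε * deriv (deriv α) t)
        (deriv v t + ε * deriv (deriv β) t) (deriv α t) (deriv β t) (deriv (deriv α) t)
        (deriv (deriv β) t))
    -- The perturbation raises `S` to at most `S + 2N ≤ (1 + 2N) S`.
    (bound := fun t => C * (1 + 2 * N) ^ p * (|deriv u t| + |deriv v t| + 1) ^ p)
    (Metric.ball_mem_nhds (0 : ℝ) hδ0) (Eventually.of_forall hmeas) ?_ ?_ ?_ (hS.const_mul _) ?_
  · simpa only [zero_mul, add_zero] using key
  · refine (hS.const_mul ((|c| * kappaConst p √(m / 2) + |d|) * √(8 * N ^ 2))).mono' (hmeas 0) ?_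
    refine (ae_restrict_iff' measurableSet_Ioo).2 (Eventually.of_forall fun t ht => ?_)
    have hb' := hbounds 0 hzero t ht
    simp only [zero_mul, add_zero] at hb' ⊢
    exact abs_density_le hp hm2 hb'.1 hb'.2
  · refine AEMeasurable.aestronglyMeasurable ?_
    simp only [densityVar, kappaVar, oddPow, kappa, ← Real.norm_eq_abs]
    fun_prop
  · refine (ae_restrict_iff' measurableSet_Ioo).2 (Eventually.of_forall fun t ht ε hε => ?_)
    have hb' := hbounds ε hε t ht
    refine (hC _ _ _ _ _ _ _ _ hb'.1 hb'.2 (bα t) (bβ t) (bα' t) (bβ' t)).trans ?_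
    rw [mul_assoc, ← Real.mul_rpow (by linarith) (by positivity)]
    have hε1 := (hball ε hε).1
    have e1 : ∀ x y : ℝ, |y| ≤ N → |x + ε * y| ≤ |x| + N := by
      intro x y hy
      refine (abs_add_le _ _).trans ?_
      rw [abs_mul]
      nlinarith [abs_nonneg y, abs_nonneg ε]
    have e2 := e1 (deriv u t) _ (bα' t)
    have e3 := e1 (deriv v t) _ (bβ' t)
    refine mul_le_mul_of_nonneg_left (Real.rpow_le_rpow (by positivity) ?_ (by linarith)) hC0
    nlinarith [abs_nonneg (deriv u t), abs_nonneg (deriv v t)]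
  · refine (ae_restrict_iff' measurableSet_Ioo).2 (Eventually.of_forall fun t ht ε hε => ?_)
    refine hasDerivAt_density hp ?_
    exact Real.sqrt_pos.1 (hm2.trans_le (hbounds ε hε t ht).1)

end IsVelocity

/-! ### The first variation and the integrated Euler-Lagrange equation. -/

/-- First component of the coefficient of `η''` in the first variation. -/
def momentFst (p u v a b : ℝ) : ℝ := -(p * oddPow p (kappa u v a b) * v / (u ^ 2 + v ^ 2))

/-- Second component of the coefficient of `η''` in the first variation. -/
def momentSnd (p u v a b : ℝ) : ℝ := p * oddPow p (kappa u v a b) * u / (u ^ 2 + v ^ 2)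

/-- First component of the coefficient of `η'` in the first variation. -/
def forceFst (p lam u v a b : ℝ) : ℝ :=
  p * oddPow p (kappa u v a b) * b / (u ^ 2 + v ^ 2)
    + (lam + (1 - 3 * p) * |kappa u v a b| ^ p) * (u / √(u ^ 2 + v ^ 2))

/-- Second component of the coefficient of `η'` in the first variation. -/
def forceSnd (p lam u v a b : ℝ) : ℝ :=
  -(p * oddPow p (kappa u v a b) * a / (u ^ 2 + v ^ 2))
    + (lam + (1 - 3 * p) * |kappa u v a b| ^ p) * (v / √(u ^ 2 + v ^ 2))

/-- The factor `1 - 3p` collects `-3p` from the cubed speed in the denominator of `k`, using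
`|k|^{p-2} k · k = |k|^p`, and `1` from `ds`. -/
theorem densityVar_eq {p lam u v a b α β α' β' : ℝ} (hp : p ≠ 0) (hq : 0 < u ^ 2 + v ^ 2) :
    densityVar 1 0 p u v a b α β α' β' + lam * densityVar 0 1 p u v a b α β α' β'
      = (α' * momentFst p u v a b + α * forceFst p lam u v a b)
        + (β' * momentSnd p u v a b + β * forceSnd p lam u v a b) := by
  have hw := oddPow_mul_self hp (kappa u v a b)
  have hr := Real.sqrt_pos.2 hq
  have hr2 := Real.sq_sqrt hq.le
  unfold densityVar kappaVar momentFst momentSnd forceFst forceSnd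
  rw [← hw, ← hr2]
  rw [Real.sqrt_sq hr.le]
  generalize oddPow p (kappa u v a b) = w
  generalize kappa u v a b = k
  generalize √(u ^ 2 + v ^ 2) = r at hr
  field_simp
  ring

namespace IsVelocity

variable {p : ℝ} {γ : ℝ → Plane} {u v : ℝ → ℝ}

theorem hasDerivAt_energy (h : IsVelocity p γ u v) (hp : 1 < p) (lam : ℝ) {η : ℝ → Plane}
    (hη : IsTest η) :
    HasDerivAt (fun ε : ℝ => bendingEnergy p (fun t => γ t + ε • η t)
        + lam * length (fun t => γ t + ε • η t))
      (∫ t in (0 : ℝ)..1,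
        ((deriv (deriv fun t => η t 0) t * momentFst p (u t) (v t) (deriv u t) (deriv v t)
          + deriv (fun t => η t 0) t * forceFst p lam (u t) (v t) (deriv u t) (deriv v t))
        + (deriv (deriv fun t => η t 1) t * momentSnd p (u t) (v t) (deriv u t) (deriv v t)
          + deriv (fun t => η t 1) t * forceSnd p lam (u t) (v t) (deriv u t) (deriv v t)))) 0 := by
  -- The pair `(c, d) = (1, 0)` is the bending energy and `(0, 1)` the length.
  obtain ⟨i1, d1⟩ := h.hasDerivAt_integral_density hp 1 0 (hη.apply 0) (hη.apply 1)
  obtain ⟨i2, d2⟩ := h.hasDerivAt_integral_density hp 0 1 (hη.apply 0) (hη.apply 1)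
  have := d1.add (d2.const_mul lam)
  simp only [h.bendingEnergy_add_smul hη, h.length_add_smul hη]
  refine this.congr_deriv ?_
  rw [← integral_const_mul, ← integral_add i1 (i2.const_mul lam), ← setIntegral_Ioo_eq]
  refine setIntegral_congr_fun measurableSet_Ioo fun t ht => ?_
  exact densityVar_eq (by linarith) (h.pos t (Ioo_subset_Icc_self ht))

theorem aemeasurable_coeff (h : IsVelocity p γ u v) {f : ℝ → ℝ → ℝ → ℝ → ℝ}
    (hf : Measurable fun z : ℝ × ℝ × ℝ × ℝ => f z.1 z.2.1 z.2.2.1 z.2.2.2) :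
    AEStronglyMeasurable (fun t => f (u t) (v t) (deriv u t) (deriv v t))
      (volume.restrict (Ioo (0 : ℝ) 1)) := by
  have := hf.comp_aemeasurable (h.aemeasurable_fst.prodMk (h.aemeasurable_snd.prodMk
    ((measurable_deriv u).aemeasurable.prodMk (measurable_deriv v).aemeasurable)))
  exact this.aestronglyMeasurable

theorem integrable_coeff (h : IsVelocity p γ u v) (hp : 1 < p) {f : ℝ → ℝ → ℝ → ℝ → ℝ}
    (hf : Measurable fun z : ℝ × ℝ × ℝ × ℝ => f z.1 z.2.1 z.2.2.1 z.2.2.2)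
    (hb : ∀ m : ℝ, 0 < m → ∃ C, ∀ u v a b : ℝ, m ≤ √(u ^ 2 + v ^ 2) →
      |f u v a b| ≤ C * (|a| + |b| + 1) ^ p) :
    IntegrableOn (fun t => f (u t) (v t) (deriv u t) (deriv v t)) (Ioo (0 : ℝ) 1) := by
  obtain ⟨m, N, hm, hmN⟩ := h.exists_bounds
  obtain ⟨C, hC⟩ := hb √m (Real.sqrt_pos.2 hm)
  refine ((h.integrable_sum_rpow hp).const_mul C).mono' (h.aemeasurable_coeff hf) ?_
  refine (ae_restrict_iff' measurableSet_Ioo).2 (Eventually.of_forall fun t ht => ?_)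
  exact hC _ _ _ _ (Real.sqrt_le_sqrt (hmN t (Ioo_subset_Icc_self ht)).1)

theorem abs_oddPow_mul_div_le (hp : 1 < p) {m u v a b x y : ℝ} (hm : 0 < m)
    (h : m ≤ √(u ^ 2 + v ^ 2)) (hx : |x| ≤ y * (|a| + |b| + 1)) (hy : 0 ≤ y) :
    |p * oddPow p (kappa u v a b) * x / (u ^ 2 + v ^ 2)|
      ≤ p * y * kappaConst p m / √(u ^ 2 + v ^ 2) ^ 2 * (|a| + |b| + 1) ^ p := by
  have hq : 0 < u ^ 2 + v ^ 2 := Real.sqrt_pos.1 (hm.trans_le h)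
  have hk := abs_oddPow_kappa_le (a := a) (b := b) hp hm h
  have hp0 : 0 < p := by linarith
  rw [Real.sq_sqrt hq.le, abs_div, abs_mul, abs_mul, abs_of_pos hq, abs_of_pos hp0,
    div_mul_eq_mul_div]
  gcongr ?_ / _
  calc p * |oddPow p (kappa u v a b)| * |x|
      ≤ p * |oddPow p (kappa u v a b)| * (y * (|a| + |b| + 1)) := by gcongr
    _ = p * y * (|oddPow p (kappa u v a b)| * (|a| + |b| + 1)) := by ring
    _ ≤ p * y * (kappaConst p m * (|a| + |b| + 1) ^ p) := by gcongr
    _ = _ := by ring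

theorem abs_moment_le (hp : 1 < p) {m : ℝ} (hm : 0 < m) : ∃ C, ∀ u v a b x : ℝ,
    m ≤ √(u ^ 2 + v ^ 2) → |x| ≤ √(u ^ 2 + v ^ 2) →
      |p * oddPow p (kappa u v a b) * x / (u ^ 2 + v ^ 2)| ≤ C * (|a| + |b| + 1) ^ p := by
  refine ⟨p * kappaConst p m / m, fun u v a b x h hx => ?_⟩
  have hr : 0 < √(u ^ 2 + v ^ 2) := hm.trans_le h
  have hc := kappaConst_nonneg p m
  have hp0 : 0 < p := by linarith
  have h1 := abs_oddPow_mul_div_le (a := a) (b := b) (x := x) hp hm h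
    (hx.trans (le_mul_of_one_le_right hr.le
      (by linarith [abs_nonneg a, abs_nonneg b]))) hr.le
  refine h1.trans ?_
  gcongr ?_ * _
  rw [show p * √(u ^ 2 + v ^ 2) * kappaConst p m / √(u ^ 2 + v ^ 2) ^ 2
    = p * kappaConst p m / √(u ^ 2 + v ^ 2) by field_simp]
  gcongr

theorem abs_force_le (hp : 1 < p) {m : ℝ} (lam : ℝ) (hm : 0 < m) : ∃ C, ∀ u v a b x y : ℝ,
    m ≤ √(u ^ 2 + v ^ 2) → |x| ≤ |a| + |b| → |y| ≤ √(u ^ 2 + v ^ 2) →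
      |p * oddPow p (kappa u v a b) * x / (u ^ 2 + v ^ 2)
        + (lam + (1 - 3 * p) * |kappa u v a b| ^ p) * (y / √(u ^ 2 + v ^ 2))|
        ≤ C * (|a| + |b| + 1) ^ p := by
  refine ⟨p * kappaConst p m / m ^ 2 + (|lam| + |1 - 3 * p| * kappaConst p m),
    fun u v a b x y h hx hy => ?_⟩
  have hr : 0 < √(u ^ 2 + v ^ 2) := hm.trans_le h
  have hc := kappaConst_nonneg p m
  have hp0 : 0 < p := by linarith
  have h1 := abs_oddPow_mul_div_le (a := a) (b := b) (x := x) (y := 1) hp hm h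
    (by linarith) zero_le_one
  have h2 : p * 1 * kappaConst p m / √(u ^ 2 + v ^ 2) ^ 2 * (|a| + |b| + 1) ^ p
      ≤ p * kappaConst p m / m ^ 2 * (|a| + |b| + 1) ^ p := by
    rw [mul_one]
    gcongr
  have h3 := abs_kappa_rpow_le (a := a) (b := b) hp hm h
  have h4 := one_le_rpow_sum (a := a) (b := b) hp
  have h5 : 0 ≤ |kappa u v a b| ^ p := by positivity
  have h6 : |(lam + (1 - 3 * p) * |kappa u v a b| ^ p) * (y / √(u ^ 2 + v ^ 2))|
      ≤ (|lam| + |1 - 3 * p| * kappaConst p m) * (|a| + |b| + 1) ^ p := by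
    rw [abs_mul, abs_div, abs_of_pos hr]
    calc _ ≤ |lam + (1 - 3 * p) * |kappa u v a b| ^ p| * 1 := by
          gcongr
          exact (div_le_one hr).2 hy
      _ ≤ |lam| + |1 - 3 * p| * |kappa u v a b| ^ p := by
          rw [mul_one]
          refine (abs_add_le _ _).trans ?_
          rw [abs_mul, abs_of_nonneg h5]
      _ ≤ |lam| * (|a| + |b| + 1) ^ p + |1 - 3 * p| * (kappaConst p m * (|a| + |b| + 1) ^ p) := by
          gcongr
          exact le_mul_of_one_le_right (abs_nonneg _) h4
      _ = _ := by ring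
  refine (abs_add_le _ _).trans ?_
  exact (add_le_add (h1.trans h2) h6).trans_eq (add_mul _ _ _).symm

theorem abs_fst_le_sqrt (u v : ℝ) : |u| ≤ √(u ^ 2 + v ^ 2) :=
  Real.abs_le_sqrt (by nlinarith [sq_nonneg v])

theorem abs_snd_le_sqrt (u v : ℝ) : |v| ≤ √(u ^ 2 + v ^ 2) :=
  Real.abs_le_sqrt (by nlinarith [sq_nonneg u])

theorem integrable_momentFst (h : IsVelocity p γ u v) (hp : 1 < p) :
    IntegrableOn (fun t => momentFst p (u t) (v t) (deriv u t) (deriv v t)) (Ioo (0 : ℝ) 1) := by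
  refine h.integrable_coeff (f := momentFst p) hp ?_ fun m hm => ?_
  · simp only [momentFst, oddPow, kappa, ← Real.norm_eq_abs]
    fun_prop
  · obtain ⟨C, hC⟩ := abs_moment_le hp hm
    refine ⟨C, fun u v a b h => ?_⟩
    rw [momentFst, abs_neg]
    exact hC u v a b v h (abs_snd_le_sqrt u v)

theorem integrable_momentSnd (h : IsVelocity p γ u v) (hp : 1 < p) :
    IntegrableOn (fun t => momentSnd p (u t) (v t) (deriv u t) (deriv v t)) (Ioo (0 : ℝ) 1) := by
  refine h.integrable_coeff (f := momentSnd p) hp ?_ fun m hm => ?_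
  · simp only [momentSnd, oddPow, kappa, ← Real.norm_eq_abs]
    fun_prop
  · obtain ⟨C, hC⟩ := abs_moment_le hp hm
    exact ⟨C, fun u v a b h => hC u v a b u h (abs_fst_le_sqrt u v)⟩

theorem integrable_forceFst (h : IsVelocity p γ u v) (hp : 1 < p) (lam : ℝ) :
    IntegrableOn (fun t => forceFst p lam (u t) (v t) (deriv u t) (deriv v t)) (Ioo (0 : ℝ) 1) := by
  refine h.integrable_coeff (f := forceFst p lam) hp ?_ fun m hm => ?_
  · simp only [forceFst, oddPow, kappa, ← Real.norm_eq_abs]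
    fun_prop
  · obtain ⟨C, hC⟩ := abs_force_le hp lam hm
    exact ⟨C, fun u v a b h => hC u v a b b u h (by linarith [abs_nonneg a])
      (abs_fst_le_sqrt u v)⟩

theorem integrable_forceSnd (h : IsVelocity p γ u v) (hp : 1 < p) (lam : ℝ) :
    IntegrableOn (fun t => forceSnd p lam (u t) (v t) (deriv u t) (deriv v t)) (Ioo (0 : ℝ) 1) := by
  refine h.integrable_coeff (f := forceSnd p lam) hp ?_ fun m hm => ?_
  · simp only [forceSnd, oddPow, kappa, ← Real.norm_eq_abs]
    fun_prop
  · obtain ⟨C, hC⟩ := abs_force_le hp lam hm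
    refine ⟨C, fun u v a b h => ?_⟩
    have := hC u v a b (-a) v h (by rw [abs_neg]; linarith [abs_nonneg b]) (abs_snd_le_sqrt u v)
    rw [forceSnd]
    convert this using 3
    ring

theorem ae_hasDerivAt_deriv {F : ℝ → ℝ} (hF : AbsolutelyContinuousOnInterval F 0 1) :
    ∀ᵐ t, t ∈ Ioo (0 : ℝ) 1 → HasDerivAt F (deriv F t) t := by
  filter_upwards [hF.ae_differentiableAt] with t h ht
  refine (h ?_).hasDerivAt
  rw [uIcc_of_le zero_le_one]
  exact Ioo_subset_Icc_self ht

/-- The Euler-Lagrange equation, integrated: `|k|^{p-2} k` is an affine function of the position. -/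
theorem exists_oddPow_kappa_eq_affine (h : IsVelocity p γ u v) (hp : 1 < p) {lam : ℝ}
    (hcrit : ∀ η : ℝ → Plane, IsTest η →
      HasDerivAt (fun ε : ℝ => bendingEnergy p (fun t => γ t + ε • η t)
        + lam * length (fun t => γ t + ε • η t)) 0 0) :
    ∃ c c₀ c₁ : ℝ, ∀ᵐ t, t ∈ Ioo (0 : ℝ) 1 →
      oddPow p (kappa (u t) (v t) (deriv u t) (deriv v t)) = c + c₀ * γ t 0 + c₁ * γ t 1 := by
  have hzero := fun η (hη : IsTest η) => (h.hasDerivAt_energy hp lam hη).unique (hcrit η hη)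
  obtain ⟨C₁, F₁, hF₁, hA₁, hd₁⟩ := exists_absolutelyContinuous_of_integral_deriv_deriv
    (h.integrable_momentFst hp) (h.integrable_forceFst hp lam) fun φ hφ => by
      have := hzero _ (hφ.smul_const (!₂[1, 0] : Plane))
      simpa using this
  obtain ⟨C₂, F₂, hF₂, hA₂, hd₂⟩ := exists_absolutelyContinuous_of_integral_deriv_deriv
    (h.integrable_momentSnd hp) (h.integrable_forceSnd hp lam) fun φ hφ => by
      have := hzero _ (hφ.smul_const (!₂[0, 1] : Plane))
      simpa using this
  have hγ0 : ∀ t ∈ Icc (0 : ℝ) 1, HasDerivWithinAt (fun t => γ t 0) (u t) (Icc 0 1) t :=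
    fun t ht => (hasDerivWithinAt_plane.1 (h.hasDeriv t ht)).1
  have hγ1 : ∀ t ∈ Icc (0 : ℝ) 1, HasDerivWithinAt (fun t => γ t 1) (v t) (Icc 0 1) t :=
    fun t ht => (hasDerivWithinAt_plane.1 (h.hasDeriv t ht)).2
  have hH : ∀ t ∈ Icc (0 : ℝ) 1, HasDerivWithinAt (fun t => C₂ * γ t 0 - C₁ * γ t 1)
      (C₂ * u t - C₁ * v t) (Icc 0 1) t := fun t ht =>
    ((hγ0 t ht).const_mul C₂).sub ((hγ1 t ht).const_mul C₁)
  have hHac : AbsolutelyContinuousOnInterval (fun t => C₂ * γ t 0 - C₁ * γ t 1) 0 1 :=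
    absolutelyContinuousOnInterval_of_hasDerivWithinAt
      ((continuousOn_const.mul h.continuousOn_fst).sub
        (continuousOn_const.mul h.continuousOn_snd)) hH
  -- In the derivative of `u F₂ - v F₁`, the terms with the acceleration cancel between moment and
  -- force, and the tangential part of the force has no cross product with the velocity. Only the
  -- constants `C₁`, `C₂` survive, and the multiplier disappears.
  obtain ⟨c, hc⟩ := AbsolutelyContinuousOnInterval.eqOn_of_ae_hasDerivAt
    (F := fun t => u t * F₂ t - v t * F₁ t) (g := fun t => C₂ * u t - C₁ * v t)
    ((h.ac_fst.fun_mul hF₂).fun_sub (h.ac_snd.fun_mul hF₁)) hHac (by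
      filter_upwards [ae_hasDerivAt_deriv h.ac_fst, ae_hasDerivAt_deriv h.ac_snd, hA₁, hA₂,
        hd₁, hd₂] with t d1 d2 a1 a2 e1 e2 ht
      refine (((d1 ht).mul (e2 ht)).sub ((d2 ht).mul (e1 ht))).congr_deriv ?_
      have hq := h.pos t (Ioo_subset_Icc_self ht)
      rw [← a1 ht, ← a2 ht]
      simp only [momentFst, momentSnd, forceFst, forceSnd]
      field_simp
      ring)
    (Eventually.of_forall fun t ht =>
      (hH t (Ioo_subset_Icc_self ht)).hasDerivAt (Icc_mem_nhds ht.1 ht.2))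
  refine ⟨c / p, C₂ / p, -(C₁ / p), ?_⟩
  filter_upwards [hA₁, hA₂] with t a1 a2 ht
  have h1 := hc t (Ioo_subset_Icc_self ht)
  have hq := h.pos t (Ioo_subset_Icc_self ht)
  simp only at h1
  rw [← a1 ht, ← a2 ht] at h1
  have h2 : u t * momentSnd p (u t) (v t) (deriv u t) (deriv v t)
      - v t * momentFst p (u t) (v t) (deriv u t) (deriv v t)
      = p * oddPow p (kappa (u t) (v t) (deriv u t) (deriv v t)) := by
    simp only [momentFst, momentSnd]
    field_simp
    ring
  have hp0 : p ≠ 0 := by linarith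
  rw [h2] at h1
  field_simp
  linarith

end IsVelocity

/-! ### Arclength reparametrization and the Frenet equations. -/

namespace IsVelocity

variable {p : ℝ} {γ : ℝ → Plane} {u v : ℝ → ℝ}

theorem norm_deriv (h : IsVelocity p γ u v) {t : ℝ} (ht : t ∈ Ioo (0 : ℝ) 1) :
    ‖deriv γ t‖ = √(u t ^ 2 + v t ^ 2) := by
  rw [((h.hasDeriv t (Ioo_subset_Icc_self ht)).hasDerivAt (Icc_mem_nhds ht.1 ht.2)).deriv,
    norm_plane]
  rfl

/-- The arclength function extends to a homeomorphism of the line. -/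
theorem exists_arclength_homeomorph (h : IsVelocity p γ u v) :
    ∃ τ : ℝ ≃ₜ ℝ, StrictMono τ ∧ τ 0 = 0 ∧ τ (length γ) = 1 ∧
      (∀ s, τ s ∈ Icc (0 : ℝ) 1 → HasDerivAt τ (√(u (τ s) ^ 2 + v (τ s) ^ 2))⁻¹ s) ∧
      ∀ s ∈ Icc 0 (length γ), arclengthParam γ s = γ (τ s) := by
  obtain ⟨m, N, hm, hmN⟩ := h.exists_bounds
  have hsm : 0 < √m := Real.sqrt_pos.2 hm
  obtain ⟨V, hV, hVρ⟩ := ContinuousOn.exists_continuous_extension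
    -- The speed is extended continuously to the line and then truncated from below by `√m`. This
    -- changes nothing on `[0,1]` and makes its primitive `σ` a homeomorphism of the whole line.
    (U := fun t => √(u t ^ 2 + v t ^ 2))
    ((h.continuousOn_fst.pow 2).add (h.continuousOn_snd.pow 2)).sqrt
  set R : ℝ → ℝ := fun t => max (V t) √m with hR
  have hRc : Continuous R := hV.max continuous_const
  have hRm : ∀ t, √m ≤ R t := fun t => le_max_right _ _
  have hReq : ∀ t ∈ Icc (0 : ℝ) 1, R t = √(u t ^ 2 + v t ^ 2) := fun t ht => by
    simp only [hR]
    rw [hVρ ht]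
    exact max_eq_left (Real.sqrt_le_sqrt (hmN t ht).1)
  set σ : ℝ → ℝ := fun t => ∫ s in (0 : ℝ)..t, R s with hσ
  have hd : ∀ t, HasDerivAt σ (R t) t := fun t =>
    intervalIntegral.integral_hasDerivAt_right (hRc.intervalIntegrable _ _)
      (hRc.stronglyMeasurableAtFilter _ _) hRc.continuousAt
  have hσ0 : σ 0 = 0 := by simp [hσ]
  have hσmono : StrictMono σ := strictMono_of_deriv_pos fun t => by
    rw [(hd t).deriv]; exact hsm.trans_le (hRm t)
  have hcmp : Monotone fun t => σ t - √m * t := by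
    have hd' : ∀ t, HasDerivAt (fun t => σ t - √m * t) (R t - √m) t := fun t => by
      simpa using (hd t).fun_sub ((hasDerivAt_id t).const_mul √m)
    exact monotone_of_deriv_nonneg (fun t => (hd' t).differentiableAt) fun t => by
      rw [(hd' t).deriv]; exact sub_nonneg.2 (hRm t)
  have hσc : Continuous σ := continuous_iff_continuousAt.2 fun t => (hd t).continuousAt
  have htop : Tendsto σ atTop atTop := by
    refine tendsto_atTop_mono' _ ?_ (tendsto_id.const_mul_atTop hsm)
    filter_upwards [eventually_ge_atTop 0] with t ht
    have := hcmp ht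
    simp only [hσ0, mul_zero, sub_zero] at this
    simp only [id]
    linarith
  have hbot : Tendsto σ atBot atBot := by
    refine tendsto_atBot_mono' _ ?_ (tendsto_id.const_mul_atBot hsm)
    filter_upwards [eventually_le_atBot 0] with t ht
    have := hcmp ht
    simp only [hσ0, mul_zero, sub_zero] at this
    simp only [id]
    linarith
  let e := (hσmono.orderIsoOfSurjective σ (hσc.surjective htop hbot)).toHomeomorph
  have he : ∀ t, e t = σ t := fun t => rfl
  have hes : ∀ s, σ (e.symm s) = s := fun s => e.apply_symm_apply s
  have harc : ∀ t ∈ Icc (0 : ℝ) 1, arclength γ t = σ t := by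
    intro t ht
    simp only [arclength, hσ]
    rw [intervalIntegral.integral_of_le ht.1, intervalIntegral.integral_of_le ht.1,
      integral_Ioc_eq_integral_Ioo, integral_Ioc_eq_integral_Ioo]
    refine setIntegral_congr_fun measurableSet_Ioo fun s hs => ?_
    have hs' : s ∈ Ioo (0 : ℝ) 1 := ⟨hs.1, hs.2.trans_le ht.2⟩
    rw [h.norm_deriv hs', hReq s (Ioo_subset_Icc_self hs')]
  have hL : length γ = σ 1 := harc 1 (by simp)
  have hsymm_mono : StrictMono e.symm := fun a b hab => by
    rw [← hσmono.lt_iff_lt, hes, hes]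
    exact hab
  have hτ0 : e.symm 0 = 0 := by rw [e.symm_apply_eq, he, hσ0]
  have hτL : e.symm (length γ) = 1 := by rw [e.symm_apply_eq, he, hL]
  refine ⟨e.symm, hsymm_mono, hτ0, hτL, fun s hs => ?_, fun s hs => ?_⟩
  · rw [← hReq _ hs]
    exact HasDerivAt.of_local_left_inverse e.symm.continuous.continuousAt (hd _)
      (hsm.trans_le (hRm _)).ne' (Eventually.of_forall hes)
  · have hmem : e.symm s ∈ Icc (0 : ℝ) 1 := by
      rw [← hτ0, ← hτL]
      exact ⟨hsymm_mono.monotone hs.1, hsymm_mono.monotone hs.2⟩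
    have hex : ∃ t ∈ Icc (0 : ℝ) 1, arclength γ t = s :=
      ⟨e.symm s, hmem, by rw [harc _ hmem, hes]⟩
    have h1 := Function.invFunOn_mem hex
    have h2 := Function.invFunOn_eq hex
    rw [arclengthParam]
    congr 1
    rw [harc _ h1] at h2
    rw [← he] at h2
    rw [← h2, e.symm_apply_apply, h2]

/-- The reciprocal of the speed is absolutely continuous. -/
theorem ac_inv_sqrt (h : IsVelocity p γ u v) :
    AbsolutelyContinuousOnInterval (fun t => (√(u t ^ 2 + v t ^ 2))⁻¹) 0 1 := by
  obtain ⟨m, N, hm, hmN⟩ := h.exists_bounds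
  have hac : AbsolutelyContinuousOnInterval (fun t => u t * u t + v t * v t) 0 1 :=
    (h.ac_fst.fun_mul h.ac_fst).fun_add (h.ac_snd.fun_mul h.ac_snd)
  have hg : ContDiffOn ℝ 1 (fun q => (√q)⁻¹) (Icc m (N ^ 2 + N ^ 2)) := by
    intro q hq
    have hq0 : 0 < q := hm.trans_le hq.1
    exact ((contDiffAt_id.sqrt hq0.ne').inv (Real.sqrt_pos.2 hq0).ne').contDiffWithinAt
  have := AbsolutelyContinuousOnInterval.comp_contDiffOn hac hg fun t ht => by
    obtain ⟨h1, h2, h3⟩ := hmN t ht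
    refine ⟨by nlinarith, ?_⟩
    have e1 : u t ^ 2 ≤ N ^ 2 := sq_le_sq' (abs_le.1 h2).1 (abs_le.1 h2).2
    have e2 : v t ^ 2 ≤ N ^ 2 := sq_le_sq' (abs_le.1 h3).1 (abs_le.1 h3).2
    nlinarith
  simpa only [← sq] using this

/-- The Frenet equations for a curve whose curvature agrees almost everywhere with a continuous
function. -/
theorem hasDerivWithinAt_tangent (h : IsVelocity p γ u v) {K : ℝ → ℝ}
    (hK : ContinuousOn K (Icc 0 1))
    (hκ : ∀ᵐ t, t ∈ Ioo (0 : ℝ) 1 → kappa (u t) (v t) (deriv u t) (deriv v t) = K t)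
    {t : ℝ} (ht : t ∈ Icc (0 : ℝ) 1) :
    HasDerivWithinAt (fun t => u t * (√(u t ^ 2 + v t ^ 2))⁻¹) (-(K t * v t)) (Icc 0 1) t ∧
      HasDerivWithinAt (fun t => v t * (√(u t ^ 2 + v t ^ 2))⁻¹) (K t * u t) (Icc 0 1) t := by
  have hsqrt : ∀ {t}, t ∈ Ioo (0 : ℝ) 1 → HasDerivAt u (deriv u t) t → HasDerivAt v (deriv v t) t →
      HasDerivAt (fun t => (√(u t ^ 2 + v t ^ 2))⁻¹)
        (-((u t * deriv u t + v t * deriv v t) / √(u t ^ 2 + v t ^ 2) ^ 3)) t := by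
    intro t ht hu hv
    have hq := h.pos t (Ioo_subset_Icc_self ht)
    have hr := Real.sqrt_pos.2 hq
    refine ((((hu.pow 2).add (hv.pow 2)).sqrt hq.ne').inv hr.ne').congr_deriv ?_
    simp only [Pi.add_apply, Pi.pow_apply]
    generalize √(u t ^ 2 + v t ^ 2) = r at hr
    field_simp
    ring
  constructor
  -- The equation is checked almost everywhere, where `u` and `v` are differentiable; continuity of
  -- the right-hand side then extends it to every point. The parameter is still `t`, so the factor
  -- `1/|γ'|` of the arclength form is absent.
  · refine AbsolutelyContinuousOnInterval.hasDerivWithinAt_of_ae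
      (U := fun t => -(K t * v t)) (h.ac_fst.fun_mul h.ac_inv_sqrt)
      (hK.mul h.continuousOn_snd).neg ?_ ht
    filter_upwards [ae_hasDerivAt_deriv h.ac_fst, ae_hasDerivAt_deriv h.ac_snd, hκ]
      with s d1 d2 hk hs
    refine ((d1 hs).mul (hsqrt hs (d1 hs) (d2 hs))).congr_deriv ?_
    have hq := h.pos s (Ioo_subset_Icc_self hs)
    have hr := Real.sqrt_pos.2 hq
    have hr2 := Real.sq_sqrt hq.le
    rw [← hk hs, kappa]
    generalize √(u s ^ 2 + v s ^ 2) = r at hr hr2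
    field_simp
    rw [hr2]
    ring
  · refine AbsolutelyContinuousOnInterval.hasDerivWithinAt_of_ae
      (U := fun t => K t * u t) (h.ac_snd.fun_mul h.ac_inv_sqrt)
      (hK.mul h.continuousOn_fst) ?_ ht
    filter_upwards [ae_hasDerivAt_deriv h.ac_fst, ae_hasDerivAt_deriv h.ac_snd, hκ]
      with s d1 d2 hk hs
    refine ((d2 hs).mul (hsqrt hs (d1 hs) (d2 hs))).congr_deriv ?_
    have hq := h.pos s (Ioo_subset_Icc_self hs)
    have hr := Real.sqrt_pos.2 hq
    have hr2 := Real.sq_sqrt hq.le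
    rw [← hk hs, kappa]
    generalize √(u s ^ 2 + v s ^ 2) = r at hr hr2
    field_simp
    rw [hr2]
    ring

end IsVelocity

/-! ### Analyticity for the exponents `p = 2m/(2m-1)`. -/

/-- With `m = j + 1` one has `(p - 2)(2j + 1) = -2j`. In the power of `w` the absolute value
therefore occurs with an even exponent and cancels against `k ^ (2j)`. -/
theorem eq_pow_of_oddPow_eq {m : ℕ} (hm : 1 ≤ m) {p k w : ℝ}
    (hp : p = 2 * (m : ℝ) / (2 * (m : ℝ) - 1)) (h : oddPow p k = w) : k = w ^ (2 * m - 1) := by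
  obtain ⟨j, rfl⟩ := Nat.exists_eq_add_of_le' hm
  have h1 : 2 * (j + 1) - 1 = 2 * j + 1 := by omega
  rw [h1, ← h]
  rcases eq_or_ne k 0 with rfl | hk
  · simp [oddPow]
  · have hk0 := abs_pos.2 hk
    rw [oddPow, mul_pow, ← Real.rpow_mul_natCast hk0.le]
    have h2 : (p - 2) * ((2 * j + 1 : ℕ) : ℝ) = -((2 * j : ℕ) : ℝ) := by
      have h3 : (2 * (j : ℝ) + 1) ≠ 0 := by positivity
      have h4 : 2 * ((j : ℝ) + 1) - 1 = 2 * j + 1 := by ring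
      rw [hp]
      push_cast
      rw [h4]
      field_simp
      ring
    rw [h2, Real.rpow_neg hk0.le, Real.rpow_natCast, pow_succ k, ← mul_assoc,
      (even_two_mul j).pow_abs, inv_mul_cancel₀ (pow_ne_zero _ hk), one_mul]

/-- A polynomial system satisfied by the position and the unit tangent of an elastica. -/
def elasticaSystem (c c₀ c₁ : ℝ) (n : ℕ) : Fin 4 → MvPolynomial (Fin 4) ℝ :=
  let W : MvPolynomial (Fin 4) ℝ := .C c + .C c₀ * .X 0 + .C c₁ * .X 1
  ![.X 2, .X 3, -(W ^ n * .X 3), W ^ n * .X 2]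

theorem isAnalyticCurve_of_isPElastica {m : ℕ} (hm : 1 ≤ m) {p : ℝ} (hp1 : 1 < p)
    (hp : p = 2 * (m : ℝ) / (2 * (m : ℝ) - 1)) {γ : ℝ → Plane} (hγ : IsPElastica p γ) :
    IsAnalyticCurve γ := by
  obtain ⟨him, lam, hcrit⟩ := hγ
  obtain ⟨u, v, h⟩ := him.exists_isVelocity hp1.le
  obtain ⟨c, c₀, c₁, hW⟩ := h.exists_oddPow_kappa_eq_affine hp1 hcrit
  set K : ℝ → ℝ := fun t => (c + c₀ * γ t 0 + c₁ * γ t 1) ^ (2 * m - 1) with hKdef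
  have hx : ∀ t ∈ Icc (0 : ℝ) 1, HasDerivWithinAt (fun t => γ t 0) (u t) (Icc 0 1) t :=
    fun t ht => (hasDerivWithinAt_plane.1 (h.hasDeriv t ht)).1
  have hy : ∀ t ∈ Icc (0 : ℝ) 1, HasDerivWithinAt (fun t => γ t 1) (v t) (Icc 0 1) t :=
    fun t ht => (hasDerivWithinAt_plane.1 (h.hasDeriv t ht)).2
  have hK : ContinuousOn K (Icc 0 1) := fun t ht =>
    ((continuousWithinAt_const.add (continuousWithinAt_const.mul (hx t ht).continuousWithinAt)).add
      (continuousWithinAt_const.mul (hy t ht).continuousWithinAt)).pow _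
  have hκ : ∀ᵐ t, t ∈ Ioo (0 : ℝ) 1 → kappa (u t) (v t) (deriv u t) (deriv v t) = K t := by
    filter_upwards [hW] with t ht1 ht2 using eq_pow_of_oddPow_eq hm hp (ht1 ht2)
  obtain ⟨τ, hτm, hτ0, hτL, hτd, hτ⟩ := h.exists_arclength_homeomorph
  have hL : 0 ≤ length γ := by
    rw [← hτm.le_iff_le, hτ0, hτL]
    exact zero_le_one
  have hmaps : MapsTo τ (Icc 0 (length γ)) (Icc 0 1) := fun s hs => by
    rw [← hτ0, ← hτL]
    exact ⟨hτm.monotone hs.1, hτm.monotone hs.2⟩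
  set α : ℝ → ℝ := fun t => u t * (√(u t ^ 2 + v t ^ 2))⁻¹ with hα
  set β : ℝ → ℝ := fun t => v t * (√(u t ^ 2 + v t ^ 2))⁻¹ with hβ
  have hcomp : ∀ {f : ℝ → ℝ} {f' s : ℝ}, s ∈ Icc 0 (length γ) →
      HasDerivWithinAt f f' (Icc 0 1) (τ s) →
      HasDerivWithinAt (fun s => f (τ s)) (f' * (√(u (τ s) ^ 2 + v (τ s) ^ 2))⁻¹)
        (Icc 0 (length γ)) s := fun hs hf =>
    hf.comp _ (hτd _ (hmaps hs)).hasDerivWithinAt hmaps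
  -- The unknowns are the position and the unit tangent `(α, β)`, all in arclength. Since `K` is a
  -- polynomial in the position, the Frenet equations close up to a polynomial system.
  have hode : ∀ i, ∀ s ∈ Icc 0 (length γ), HasDerivWithinAt
      ((![fun s => γ (τ s) 0, fun s => γ (τ s) 1, fun s => α (τ s), fun s => β (τ s)] :
        Fin 4 → ℝ → ℝ) i)
      (MvPolynomial.eval (fun j => (![fun s => γ (τ s) 0, fun s => γ (τ s) 1, fun s => α (τ s),
        fun s => β (τ s)] : Fin 4 → ℝ → ℝ) j s) (elasticaSystem c c₀ c₁ (2 * m - 1) i))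
      (Icc 0 (length γ)) s := by
    intro i s hs
    have h1 := hcomp hs (hx _ (hmaps hs))
    have h2 := hcomp hs (hy _ (hmaps hs))
    have h3 := hcomp hs (h.hasDerivWithinAt_tangent hK hκ (hmaps hs)).1
    have h4 := hcomp hs (h.hasDerivWithinAt_tangent hK hκ (hmaps hs)).2
    fin_cases i
    · simpa [elasticaSystem] using h1
    · simpa [elasticaSystem] using h2
    · refine h3.congr_deriv ?_
      simp [elasticaSystem, hβ, hKdef]
      ring
    · refine h4.congr_deriv ?_
      simp [elasticaSystem, hα, hKdef]
      ring
  intro s hs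
  have a0 := analyticWithinAt_of_polynomial_ode _ hL _ hode hs 0
  have a1 := analyticWithinAt_of_polynomial_ode _ hL _ hode hs 1
  have hsum := (a0.smul (analyticWithinAt_const (v := (!₂[1, 0] : Plane)))).add
    (a1.smul (analyticWithinAt_const (v := (!₂[0, 1] : Plane))))
  have heq : ∀ s ∈ Icc 0 (length γ), arclengthParam γ s
      = γ (τ s) 0 • (!₂[1, 0] : Plane) + γ (τ s) 1 • (!₂[0, 1] : Plane) := by
    intro s hs
    rw [hτ s hs]
    ext i
    fin_cases i <;> simp
  exact hsum.congr (fun s hs => heq s hs) (heq s hs)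

/-! ### Exact regularity of powers at the origin. -/

theorem ContDiffAt.deriv_of_succ {F : Type*} [NormedAddCommGroup F] [NormedSpace ℝ F]
    {f : ℝ → F} {x : ℝ} {n : ℕ} (h : ContDiffAt ℝ (n + 1 : ℕ) f x) :
    ContDiffAt ℝ n (deriv f) x :=
  h.derivWithin (by push_cast; exact le_rfl)

theorem hasDerivAt_oddPow {p : ℝ} (hp : 2 < p) (x : ℝ) :
    HasDerivAt (oddPow p) ((p - 1) * |x| ^ (p - 2)) x := by
  rcases eq_or_ne x 0 with rfl | hx
  · rw [abs_zero, Real.zero_rpow (by linarith), mul_zero, hasDerivAt_iff_tendsto_slope]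
    have h : Tendsto (fun y : ℝ => |y| ^ (p - 2)) (𝓝[≠] 0) (𝓝 0) := by
      have hc : Continuous (fun y : ℝ => |y| ^ (p - 2)) :=
        continuous_abs.rpow_const fun _ => Or.inr (by linarith)
      have := hc.tendsto 0
      rw [abs_zero, Real.zero_rpow (by linarith)] at this
      exact this.mono_left nhdsWithin_le_nhds
    refine h.congr' ?_
    filter_upwards [self_mem_nhdsWithin] with y hy
    have hy' : y ≠ 0 := hy
    simp only [slope_def_field, oddPow]
    field_simp
    simp
  · have h1 : HasDerivAt (fun y : ℝ => |y| ^ (p - 2)) _ x :=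
      (hasDerivAt_abs hx).rpow_const (p := p - 2) (Or.inl (abs_ne_zero.2 hx))
    refine (h1.mul (hasDerivAt_id x)).congr_deriv ?_
    have h2 : |x| ^ (p - 2) = |x| ^ (p - 2 - 1) * |x| := by
      rw [← Real.rpow_add_one (abs_ne_zero.2 hx)]
      ring_nf
    have h3 : (SignType.sign x : ℝ) * x = |x| := by
      rw [mul_comm]; exact self_mul_sign x
    simp only [id]
    linear_combination (p - 2) * |x| ^ (p - 2 - 1) * h3 - (p - 2) * h2

theorem continuous_oddPow {p : ℝ} (hp : 1 < p) : Continuous (oddPow p) := by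
  have h := (contDiff_norm_rpow (E := ℝ) hp).continuous_deriv le_rfl
  have h1 : deriv (fun x : ℝ => ‖x‖ ^ p) = fun x => p * oddPow p x :=
    funext fun x => (hasDerivAt_abs_rpow' hp x).deriv
  rw [h1] at h
  have hp0 : p ≠ 0 := by linarith
  have := h.const_mul p⁻¹
  refine this.congr fun x => ?_
  field_simp

/-- The function is even, so its derivative at `0` would vanish; but the difference quotients
`y^{s-1}` are at least `1` for `0 < y < 1`. -/
theorem not_differentiableAt_abs_rpow {s : ℝ} (h0 : 0 < s) (h1 : s ≤ 1) :
    ¬ DifferentiableAt ℝ (fun y : ℝ => |y| ^ s) 0 := by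
  intro hd
  have h := hd.hasDerivAt
  have hneg : HasDerivAt (fun y : ℝ => |y| ^ s) (-deriv (fun y : ℝ => |y| ^ s) 0) 0 := by
    have h' : HasDerivAt (fun y : ℝ => |y| ^ s) (deriv (fun y : ℝ => |y| ^ s) 0) (-0) := by
      rwa [neg_zero]
    have := h'.scomp 0 (hasDerivAt_neg 0)
    simpa [Function.comp_def] using this
  have hz : deriv (fun y : ℝ => |y| ^ s) 0 = 0 := by linarith [h.unique hneg]
  rw [hz, hasDerivAt_iff_tendsto_slope] at h
  have h2 : ∀ᶠ y in 𝓝[>] (0 : ℝ), 1 ≤ slope (fun y : ℝ => |y| ^ s) 0 y := by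
    filter_upwards [Ioo_mem_nhdsGT (zero_lt_one' ℝ)] with y hy
    rw [slope_def_field, abs_zero, Real.zero_rpow h0.ne', sub_zero, sub_zero, abs_of_pos hy.1,
      le_div_iff₀ hy.1, one_mul]
    calc y = y ^ (1 : ℝ) := (Real.rpow_one y).symm
      _ ≤ y ^ s := Real.rpow_le_rpow_of_exponent_ge hy.1 hy.2.le h1
  have h3 := ge_of_tendsto (h.mono_left (nhdsGT_le_nhdsNE 0)) h2
  linarith

theorem not_differentiableAt_oddPow {s : ℝ} (h1 : s < 1) :
    ¬ DifferentiableAt ℝ (oddPow (s + 1)) 0 := by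
  intro hd
  have h := hd.hasDerivAt
  rw [hasDerivAt_iff_tendsto_slope] at h
  have h2 : Tendsto (fun y : ℝ => y ^ (s - 1)) (𝓝[>] 0) atTop :=
    tendsto_rpow_neg_nhdsGT_zero (by linarith)
  have h3 : (fun y : ℝ => y ^ (s - 1)) =ᶠ[𝓝[>] 0] slope (oddPow (s + 1)) 0 := by
    filter_upwards [self_mem_nhdsWithin] with y hy
    have hy' : 0 < y := hy
    rw [slope_def_field, oddPow, oddPow, mul_zero, sub_zero, sub_zero, abs_of_pos hy',
      mul_div_assoc, div_self hy'.ne', mul_one]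
    ring_nf
  exact not_tendsto_nhds_of_tendsto_atTop (h2.congr' h3) _ (h.mono_left (nhdsGT_le_nhdsNE 0))

/-- The powers `|y|^s` and `|y|^{s-1} y` have no more derivatives at the origin than expected. -/
theorem eq_of_contDiffAt_abs_rpow (n : ℕ) : ∀ s : ℝ, (n : ℝ) < s → s ≤ n + 1 →
    (ContDiffAt ℝ (n + 1 : ℕ) (fun y : ℝ => |y| ^ s) 0 → s = n + 1 ∧ Even (n + 1)) ∧
      (ContDiffAt ℝ (n + 1 : ℕ) (oddPow (s + 1)) 0 → s = n + 1 ∧ Odd (n + 1)) := by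
  induction n with
  | zero =>
    intro s h0 h1
    simp only [Nat.cast_zero, zero_add] at h0 h1 ⊢
    refine ⟨fun h => ?_, fun h => ?_⟩
    · exact absurd (h.differentiableAt (by simp)) (not_differentiableAt_abs_rpow h0 h1)
    · refine ⟨?_, odd_one⟩
      by_contra hne
      exact not_differentiableAt_oddPow (lt_of_le_of_ne h1 hne) (h.differentiableAt (by simp))
  | succ n ih =>
    intro s h0 h1
    push_cast at h0 h1 ⊢
    have hs : 1 < s := by linarith [(n.cast_nonneg : (0 : ℝ) ≤ n)]
    -- `oddPow (s + 1)` is homogeneous of degree `s`. Differentiation exchanges the even and the odd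
    -- family, lowering the degree by one and flipping the parity of the admissible integer.
    obtain ⟨ih1, ih2⟩ := ih (s - 1) (by linarith) (by linarith)
    refine ⟨fun h => ?_, fun h => ?_⟩
    · have h2 := ContDiffAt.deriv_of_succ (n := n + 1) h
      rw [funext fun y => (hasDerivAt_abs_rpow' hs y).deriv] at h2
      have h3 := contDiffAt_const (c := s⁻¹).mul h2
      obtain ⟨e1, e2⟩ := ih2 (h3.congr_of_eventuallyEq (Eventually.of_forall fun y => by
        have hs0 : s ≠ 0 := by linarith
        rw [sub_add_cancel]
        field_simp))
      exact ⟨by linarith, e2.add_one⟩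
    · have h2 := ContDiffAt.deriv_of_succ (n := n + 1) h
      have e : deriv (oddPow (s + 1)) = fun y => (s + 1 - 1) * |y| ^ (s + 1 - 2) :=
        funext fun y => (hasDerivAt_oddPow (by linarith) y).deriv
      rw [e] at h2
      have h3 := contDiffAt_const (c := s⁻¹).mul h2
      obtain ⟨e1, e2⟩ := ih1 (h3.congr_of_eventuallyEq (Eventually.of_forall fun y => by
        have hs0 : s ≠ 0 := by linarith
        rw [show s + 1 - 1 = s by ring, show s + 1 - 2 = s - 1 by ring]
        field_simp))
      exact ⟨by linarith, e2.add_one⟩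

/-! ### A sufficient criterion for being an elastica. -/

theorem memL_of_components {p : ℝ} {f g : ℝ → ℝ}
    (hf : MemLp f (ENNReal.ofReal p) (volume.restrict (Ioo 0 1)))
    (hg : MemLp g (ENNReal.ofReal p) (volume.restrict (Ioo 0 1))) :
    MemL p (fun t => !₂[f t, g t]) := by
  have h1 := (ContinuousLinearMap.toSpanSingleton ℝ (!₂[1, 0] : Plane)).comp_memLp' hf
  have h2 := (ContinuousLinearMap.toSpanSingleton ℝ (!₂[0, 1] : Plane)).comp_memLp' hg
  refine MemLp.ae_eq (Eventually.of_forall fun t => ?_) (h1.add h2)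
  ext i
  fin_cases i <;> simp

theorem ContinuousOn.memLp_Ioo {f : ℝ → ℝ} (hf : ContinuousOn f (Icc 0 1)) (p : ENNReal) :
    MemLp f p (volume.restrict (Ioo 0 1)) := by
  obtain ⟨C, hC⟩ := isCompact_Icc.exists_bound_of_continuousOn hf
  exact MemLp.of_bound
    ((hf.mono Ioo_subset_Icc_self).aestronglyMeasurable measurableSet_Ioo) C
    ((ae_restrict_iff' measurableSet_Ioo).2
      (Eventually.of_forall fun t ht => hC t (Ioo_subset_Icc_self ht)))

theorem hasWeakDeriv_of_ac {p : ℝ} (hp : 1 ≤ p) {f g : ℝ → Plane} (hf : MemL p f) (hg : MemL p g)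
    (hac : ∀ i, AbsolutelyContinuousOnInterval (fun t => f t i) 0 1)
    (hd : ∀ i, ∀ t ∈ Ioo (0 : ℝ) 1, deriv (fun t => f t i) t = g t i) : HasWeakDeriv f g := by
  intro φ hφ
  ext i
  rw [PiLp.neg_apply, setIntegral_smul_apply hp hφ.deriv hf, setIntegral_smul_apply hp hφ hg,
    hφ.integral_deriv_mul (hac i), ← setIntegral_Ioo_eq, ← setIntegral_Ioo_eq]
  congr 1
  exact setIntegral_congr_fun measurableSet_Ioo fun t ht => by rw [hd i t ht]

namespace IsVelocity

variable {p : ℝ} {γ : ℝ → Plane} {u v : ℝ → ℝ}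

theorem isImmersedW2 (h : IsVelocity p γ u v) (hp : 1 ≤ p) : IsImmersedW2 p γ := by
  have hc : ContinuousOn γ (Icc 0 1) := fun t ht => (h.hasDeriv t ht).continuousWithinAt
  have hx : ∀ t ∈ Icc (0 : ℝ) 1, HasDerivWithinAt (fun t => γ t 0) (u t) (Icc 0 1) t :=
    fun t ht => (hasDerivWithinAt_plane.1 (h.hasDeriv t ht)).1
  have hy : ∀ t ∈ Icc (0 : ℝ) 1, HasDerivWithinAt (fun t => γ t 1) (v t) (Icc 0 1) t :=
    fun t ht => (hasDerivWithinAt_plane.1 (h.hasDeriv t ht)).2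
  have hγ : MemL p γ := by
    have := memL_of_components (p := p)
      (ContinuousOn.memLp_Ioo ((coordCLM 0).continuous.comp_continuousOn hc) _)
      (ContinuousOn.memLp_Ioo ((coordCLM 1).continuous.comp_continuousOn hc) _)
    refine MemLp.ae_eq (Eventually.of_forall fun t => ?_) this
    ext i
    fin_cases i <;> rfl
  have hV : MemL p (fun t => !₂[u t, v t]) := memL_of_components
    (ContinuousOn.memLp_Ioo h.continuousOn_fst _) (ContinuousOn.memLp_Ioo h.continuousOn_snd _)
  have ha : MemL p (fun t => !₂[deriv u t, deriv v t]) :=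
    memL_of_components h.memLp_fst h.memLp_snd
  refine ⟨hc, ⟨hγ, _, _, hV, ha, hasWeakDeriv_of_ac hp hγ hV ?_ ?_,
    hasWeakDeriv_of_ac hp hV ha ?_ ?_⟩, fun t ht => ?_⟩
  · rw [Fin.forall_fin_two]
    exact ⟨absolutelyContinuousOnInterval_of_hasDerivWithinAt h.continuousOn_fst hx,
      absolutelyContinuousOnInterval_of_hasDerivWithinAt h.continuousOn_snd hy⟩
  · rw [Fin.forall_fin_two]
    exact ⟨fun t ht => ((hx t (Ioo_subset_Icc_self ht)).hasDerivAt (Icc_mem_nhds ht.1 ht.2)).deriv,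
      fun t ht => ((hy t (Ioo_subset_Icc_self ht)).hasDerivAt (Icc_mem_nhds ht.1 ht.2)).deriv⟩
  · rw [Fin.forall_fin_two]
    exact ⟨h.ac_fst, h.ac_snd⟩
  · rw [Fin.forall_fin_two]
    exact ⟨fun t _ => rfl, fun t _ => rfl⟩
  · rw [(h.hasDeriv t ht).derivWithin (uniqueDiffOn_Icc zero_lt_one t ht)]
    intro h0
    have h1 := congrArg (fun z : Plane => z 0) h0
    have h2 := congrArg (fun z : Plane => z 1) h0
    simp only [PiLp.zero_apply] at h1 h2
    have h3 : u t = 0 := h1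
    have h4 : v t = 0 := h2
    have := h.pos t ht
    simp [h3, h4] at this

/-- Converse to the second order du Bois-Reymond lemma: one integration by parts turns `φ'' F` into
`-φ' (B + C)`, and `∫ φ' C = 0`. -/
theorem integral_variation_eq_zero {A B F : ℝ → ℝ} {C : ℝ}
    (hB : IntegrableOn B (Ioo 0 1)) (hF : AbsolutelyContinuousOnInterval F 0 1)
    (hA : ∀ t ∈ Ioo (0 : ℝ) 1, A t = F t)
    (hF' : ∀ t ∈ Ioo (0 : ℝ) 1, HasDerivAt F (B t + C) t) {φ : ℝ → ℝ} (hφ : IsTest φ) :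
    ∫ t in (0 : ℝ)..1, (deriv (deriv φ) t * A t + deriv φ t * B t) = 0 := by
  have h1 := hφ.deriv.integral_deriv_mul hF
  have h2 := hφ.integral_deriv_mul
    ((contDiffOn_const (c := C)).absolutelyContinuousOnInterval (a := 0) (b := 1))
  have i1 := intervalIntegrable_of_Ioo (hφ.deriv.integrable_mul hB)
  have i2 : IntervalIntegrable (fun t => deriv φ t * C) volume 0 1 :=
    (hφ.deriv.continuous.intervalIntegrable _ _).mul_const _
  have hFi : IntegrableOn F (Ioo 0 1) := by
    have := hF.continuousOn
    rw [uIcc_of_le zero_le_one] at this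
    exact this.integrableOn_Icc.mono_set Ioo_subset_Icc_self
  have i3 := intervalIntegrable_of_Ioo (hφ.deriv.deriv.integrable_mul hFi)
  have e1 : ∫ t in (0 : ℝ)..1, deriv φ t * deriv F t
      = ∫ t in (0 : ℝ)..1, (deriv φ t * B t + deriv φ t * C) := by
    rw [← setIntegral_Ioo_eq, ← setIntegral_Ioo_eq]
    refine setIntegral_congr_fun measurableSet_Ioo fun t ht => ?_
    rw [(hF' t ht).deriv, mul_add]
  have e2 : ∫ t in (0 : ℝ)..1, (deriv (deriv φ) t * A t + deriv φ t * B t)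
      = ∫ t in (0 : ℝ)..1, (deriv (deriv φ) t * F t + deriv φ t * B t) := by
    rw [← setIntegral_Ioo_eq, ← setIntegral_Ioo_eq]
    refine setIntegral_congr_fun measurableSet_Ioo fun t ht => ?_
    rw [hA t ht]
  simp only [deriv_const, mul_zero, intervalIntegral.integral_zero, neg_zero] at h2
  rw [e2, intervalIntegral.integral_add i3 i1, h1, e1, intervalIntegral.integral_add i1 i2, h2]
  ring

/-- A curve satisfying the integrated Euler-Lagrange equation is an elastica. -/
theorem isPElastica (h : IsVelocity p γ u v) (hp : 1 < p) {lam C₁ C₂ : ℝ} {F₁ F₂ : ℝ → ℝ}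
    (hF₁ : AbsolutelyContinuousOnInterval F₁ 0 1) (hF₂ : AbsolutelyContinuousOnInterval F₂ 0 1)
    (hA₁ : ∀ t ∈ Ioo (0 : ℝ) 1, momentFst p (u t) (v t) (deriv u t) (deriv v t) = F₁ t)
    (hA₂ : ∀ t ∈ Ioo (0 : ℝ) 1, momentSnd p (u t) (v t) (deriv u t) (deriv v t) = F₂ t)
    (hd₁ : ∀ t ∈ Ioo (0 : ℝ) 1,
      HasDerivAt F₁ (forceFst p lam (u t) (v t) (deriv u t) (deriv v t) + C₁) t)
    (hd₂ : ∀ t ∈ Ioo (0 : ℝ) 1,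
      HasDerivAt F₂ (forceSnd p lam (u t) (v t) (deriv u t) (deriv v t) + C₂) t) :
    IsPElastica p γ := by
  refine ⟨h.isImmersedW2 hp.le, lam, fun η hη => ?_⟩
  refine (h.hasDerivAt_energy hp lam hη).congr_deriv ?_
  have i : ∀ {φ A B : ℝ → ℝ}, IsTest φ → IntegrableOn A (Ioo 0 1) → IntegrableOn B (Ioo 0 1) →
      IntervalIntegrable (fun t => deriv (deriv φ) t * A t + deriv φ t * B t) volume 0 1 :=
    fun hφ hA hB => (intervalIntegrable_of_Ioo (hφ.deriv.deriv.integrable_mul hA)).add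
      (intervalIntegrable_of_Ioo (hφ.deriv.integrable_mul hB))
  rw [intervalIntegral.integral_add
      (i (hη.apply 0) (h.integrable_momentFst hp) (h.integrable_forceFst hp lam))
      (i (hη.apply 1) (h.integrable_momentSnd hp) (h.integrable_forceSnd hp lam)),
    integral_variation_eq_zero (h.integrable_forceFst hp lam) hF₁ hA₁ hd₁ (hη.apply 0),
    integral_variation_eq_zero (h.integrable_forceSnd hp lam) hF₂ hA₂ hd₂ (hη.apply 1), add_zero]

end IsVelocity

/-! ### The rectangular elastica. -/

/-- The cosine of the tangent angle of the rectangular elastica, as a function of the height. -/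
def profile (r t : ℝ) : ℝ := |t - 1 / 2| ^ (r + 1) / (r + 1)

/-- The slope `dx/dy` of the rectangular elastica. -/
def profileSlope (r t : ℝ) : ℝ := profile r t * (√(1 - profile r t ^ 2))⁻¹

section Profile

variable {r t : ℝ}

/-- The height is centred at `1/2` so that the inflection point is interior. Heights at most `1/2`
from it keep the cosine away from `1`, so the curve remains a graph over the `y`-axis. -/
theorem profile_bounds (hr : 0 < r) (ht : t ∈ Icc (0 : ℝ) 1) :
    0 ≤ profile r t ∧ profile r t ≤ 1 / 2 := by
  have h1 : |t - 1 / 2| ≤ 1 / 2 := abs_le.2 ⟨by linarith [ht.1], by linarith [ht.2]⟩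
  refine ⟨by unfold profile; positivity, ?_⟩
  rw [profile, div_le_iff₀ (by linarith)]
  rcases eq_or_ne |t - 1 / 2| 0 with h0 | h0
  · rw [h0, Real.zero_rpow (by linarith)]
    linarith
  calc |t - 1 / 2| ^ (r + 1) ≤ |t - 1 / 2| ^ (1 : ℝ) :=
        Real.rpow_le_rpow_of_exponent_ge (lt_of_le_of_ne (abs_nonneg _) h0.symm) (by linarith)
          (by linarith)
    _ = |t - 1 / 2| := Real.rpow_one _
    _ ≤ 1 / 2 * (r + 1) := by linarith

theorem one_sub_profile_sq_pos (hr : 0 < r) (ht : t ∈ Icc (0 : ℝ) 1) :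
    0 < 1 - profile r t ^ 2 := by
  obtain ⟨h1, h2⟩ := profile_bounds hr ht
  nlinarith

theorem hasDerivAt_profile (hr : 0 < r) (t : ℝ) :
    HasDerivAt (profile r) (oddPow (r + 1) (t - 1 / 2)) t := by
  have h := (hasDerivAt_abs_rpow' (p := r + 1) (by linarith) (t - 1 / 2)).comp t
    ((hasDerivAt_id t).sub_const (1 / 2))
  refine (h.div_const (r + 1)).congr_deriv ?_
  have : r + 1 ≠ 0 := by linarith
  field_simp

theorem contDiff_profile (hr : 0 < r) : ContDiff ℝ 1 (profile r) := by
  have h : ContDiff ℝ 1 (fun t : ℝ => ‖t - 1 / 2‖ ^ (r + 1)) :=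
    (contDiff_id.sub contDiff_const).norm_rpow (by linarith)
  exact h.div_const _

theorem contDiffAt_sqrt_profile (hr : 0 < r) (ht : t ∈ Icc (0 : ℝ) 1) :
    ContDiffAt ℝ 1 (fun t => √(1 - profile r t ^ 2)) t :=
  (contDiffAt_const.sub ((contDiff_profile hr).contDiffAt.pow 2)).sqrt
    (one_sub_profile_sq_pos hr ht).ne'

theorem hasDerivAt_sqrt_profile (hr : 0 < r) (ht : t ∈ Icc (0 : ℝ) 1) :
    HasDerivAt (fun t => √(1 - profile r t ^ 2))
      (-(profile r t * oddPow (r + 1) (t - 1 / 2)) / √(1 - profile r t ^ 2)) t := by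
  have h0 := one_sub_profile_sq_pos hr ht
  have := (((hasDerivAt_profile hr t).pow 2).const_sub 1).sqrt h0.ne'
  refine this.congr_deriv ?_
  have h1 := Real.sqrt_pos.2 h0
  simp only [Pi.pow_apply]
  field_simp
  ring

theorem contDiffAt_profileSlope (hr : 0 < r) (ht : t ∈ Icc (0 : ℝ) 1) :
    ContDiffAt ℝ 1 (profileSlope r) t :=
  (contDiff_profile hr).contDiffAt.mul ((contDiffAt_sqrt_profile hr ht).inv
    (Real.sqrt_pos.2 (one_sub_profile_sq_pos hr ht)).ne')

theorem hasDerivAt_profileSlope (hr : 0 < r) (ht : t ∈ Icc (0 : ℝ) 1) :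
    HasDerivAt (profileSlope r)
      (oddPow (r + 1) (t - 1 / 2) / √(1 - profile r t ^ 2) ^ 3) t := by
  have h0 := one_sub_profile_sq_pos hr ht
  have h1 := Real.sqrt_pos.2 h0
  have h2 := Real.sq_sqrt h0.le
  refine ((hasDerivAt_profile hr t).mul ((hasDerivAt_sqrt_profile hr ht).inv h1.ne')).congr_deriv ?_
  simp only [Pi.inv_apply]
  generalize √(1 - profile r t ^ 2) = g at h1 h2
  field_simp
  rw [h2]
  ring

theorem profileSlope_sq_add_one (hr : 0 < r) (ht : t ∈ Icc (0 : ℝ) 1) :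
    profileSlope r t ^ 2 + 1 ^ 2 = ((√(1 - profile r t ^ 2))⁻¹) ^ 2 := by
  have h0 := one_sub_profile_sq_pos hr ht
  have h1 := Real.sqrt_pos.2 h0
  have h2 := Real.sq_sqrt h0.le
  unfold profileSlope
  generalize √(1 - profile r t ^ 2) = g at h1 h2
  field_simp
  linarith

/-- If `f = cos θ` and `dy/ds = sin θ`, then `df/dy = -dθ/ds = -k`. -/
theorem kappa_profileSlope (hr : 0 < r) (ht : t ∈ Icc (0 : ℝ) 1) :
    kappa (profileSlope r t) 1 (deriv (profileSlope r) t) 0 = -oddPow (r + 1) (t - 1 / 2) := by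
  have h1 := Real.sqrt_pos.2 (one_sub_profile_sq_pos hr ht)
  rw [kappa, profileSlope_sq_add_one hr ht, (hasDerivAt_profileSlope hr ht).deriv,
    Real.sqrt_sq (inv_pos.2 h1).le]
  field_simp
  ring

end Profile

theorem oddPow_neg (p k : ℝ) : oddPow p (-k) = -oddPow p k := by
  simp [oddPow]

/-- The two odd powers are homogeneous of the reciprocal degrees `p - 1` and `r`. This makes
`|k|^{p-2} k` affine in the height on the rectangular elastica. -/
theorem oddPow_oddPow {p r : ℝ} (h : (p - 1) * r = 1) (k : ℝ) :
    oddPow p (oddPow (r + 1) k) = k := by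
  rcases eq_or_ne k 0 with rfl | hk
  · simp [oddPow]
  · have hk0 := abs_pos.2 hk
    have hr : r ≠ 0 := by rintro rfl; simp at h
    rw [oddPow, abs_oddPow (by simpa using hr), ← Real.rpow_mul hk0.le, oddPow, ← mul_assoc,
      ← Real.rpow_add hk0]
    have : (r + 1 - 1) * (p - 2) + (r + 1 - 2) = 0 := by linear_combination h
    rw [this, Real.rpow_zero, one_mul]

/-- The rectangular elastica `x = ∫ f / √(1 - f²) dy`, as a graph over the `y`-axis. -/
theorem exists_rectangular_elastica {p r : ℝ} (hp : 1 < p) (hr : 0 < r) (hpr : (p - 1) * r = 1) :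
    ∃ γ : ℝ → Plane, IsPElastica p γ ∧ IsVelocity p γ (profileSlope r) (fun _ => 1) ∧
      ∀ t, γ t 1 = t := by
  have hcd : ContDiffOn ℝ 1 (profileSlope r) (Icc 0 1) := fun t ht =>
    (contDiffAt_profileSlope hr ht).contDiffWithinAt
  obtain ⟨V, hV, hVU⟩ := ContinuousOn.exists_continuous_extension hcd.continuousOn
  have hd : ∀ t, HasDerivAt (fun t => ∫ s in (0 : ℝ)..t, V s) (V t) t := fun t =>
    intervalIntegral.integral_hasDerivAt_right (hV.intervalIntegrable _ _)
      (hV.stronglyMeasurableAtFilter _ _) hV.continuousAt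
  have hvel : IsVelocity p (fun t => !₂[∫ s in (0 : ℝ)..t, V s, t]) (profileSlope r)
      (fun _ => 1) := by
    refine ⟨?_, ?_, ?_, ?_, fun t ht => ?_, fun t ht => ?_⟩
    · refine ContDiffOn.absolutelyContinuousOnInterval ?_
      rwa [uIcc_of_le zero_le_one]
    · exact contDiffOn_const.absolutelyContinuousOnInterval
    · refine ContinuousOn.memLp_Ioo (f := deriv (profileSlope r)) ?_ _
      have hc : ContinuousOn (fun t => oddPow (r + 1) (t - 1 / 2) / √(1 - profile r t ^ 2) ^ 3)
          (Icc 0 1) := fun t ht =>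
        ((((continuous_oddPow (by linarith)).comp (continuous_id.sub continuous_const)).continuousAt
          (x := t)).div ((contDiffAt_sqrt_profile hr ht).continuousAt.pow 3)
          (pow_ne_zero 3 (Real.sqrt_pos.2
            (one_sub_profile_sq_pos hr ht)).ne')).continuousWithinAt
      exact hc.congr fun t ht => (hasDerivAt_profileSlope hr ht).deriv
    · simp
    · refine hasDerivWithinAt_plane.2 ⟨?_, ?_⟩
      · have := hd t
        rw [hVU ht] at this
        exact this.hasDerivWithinAt
      · exact hasDerivWithinAt_id t _
    · positivity
  refine ⟨_, ?_, hvel, fun t => rfl⟩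
  have hw : ∀ t ∈ Icc (0 : ℝ) 1,
      oddPow p (kappa (profileSlope r t) 1 (deriv (profileSlope r) t) 0) = -(t - 1 / 2) := by
    intro t ht
    rw [kappa_profileSlope hr ht, oddPow_neg, oddPow_oddPow hpr]
  have habs : ∀ t ∈ Icc (0 : ℝ) 1,
      |kappa (profileSlope r t) 1 (deriv (profileSlope r) t) 0| ^ p = (r + 1) * profile r t := by
    intro t ht
    have hr1 : r + 1 ≠ 0 := by linarith
    rw [← oddPow_mul_self (by linarith), hw t ht, kappa_profileSlope hr ht, profile,
      ← oddPow_mul_self hr1]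
    field_simp
  have hE : ∀ t, (t - 1 / 2) * oddPow (r + 1) (t - 1 / 2) = (r + 1) * profile r t := by
    intro t
    have hr1 : r + 1 ≠ 0 := by linarith
    rw [profile, ← oddPow_mul_self hr1]
    field_simp
  have hF₁ : ∀ t ∈ Icc (0 : ℝ) 1, ContDiffWithinAt ℝ 1
      (fun t => p * (t - 1 / 2) * (1 - profile r t ^ 2)) (Icc 0 1) t := fun t ht =>
    ((contDiff_const.mul (contDiff_id.sub contDiff_const)).mul
      (contDiff_const.sub ((contDiff_profile hr).pow 2))).contDiffWithinAt
  have hF₂ : ∀ t ∈ Icc (0 : ℝ) 1, ContDiffWithinAt ℝ 1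
      (fun t => -(p * (t - 1 / 2) * profile r t * √(1 - profile r t ^ 2))) (Icc 0 1) t :=
    fun t ht => ((((contDiff_const.mul (contDiff_id.sub contDiff_const)).mul
      (contDiff_profile hr)).contDiffAt.mul (contDiffAt_sqrt_profile hr ht)).neg).contDiffWithinAt
  -- `F₁` and `F₂` are the moments with `|k|^{p-2} k = -(t - 1/2)` and the speed `1/√(1 - f²)`
  -- inserted. Then `F₁' = p + (1 - 3p)(r + 1) f²` by `(p - 1)(r + 1) = p`, which accounts for `C₁ =
  -- p`.
  refine hvel.isPElastica hp (lam := 0) (C₁ := p) (C₂ := 0)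
    (F₁ := fun t => p * (t - 1 / 2) * (1 - profile r t ^ 2))
    (F₂ := fun t => -(p * (t - 1 / 2) * profile r t * √(1 - profile r t ^ 2)))
    ?_ ?_ ?_ ?_ ?_ ?_
  · refine ContDiffOn.absolutelyContinuousOnInterval ?_
    rwa [uIcc_of_le zero_le_one]
  · refine ContDiffOn.absolutelyContinuousOnInterval ?_
    rwa [uIcc_of_le zero_le_one]
  · intro t ht
    have ht' := Ioo_subset_Icc_self ht
    have h0 := one_sub_profile_sq_pos hr ht'
    rw [deriv_const, momentFst, hw t ht', profileSlope_sq_add_one hr ht', inv_pow,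
      Real.sq_sqrt h0.le]
    field_simp
  · intro t ht
    have ht' := Ioo_subset_Icc_self ht
    have h0 := one_sub_profile_sq_pos hr ht'
    have h1 := Real.sqrt_pos.2 h0
    rw [deriv_const, momentSnd, hw t ht', profileSlope_sq_add_one hr ht', profileSlope]
    field_simp
  · intro t ht
    have ht' := Ioo_subset_Icc_self ht
    have h0 := one_sub_profile_sq_pos hr ht'
    have h1 := Real.sqrt_pos.2 h0
    have h := (((hasDerivAt_id t).sub_const (1 / 2)).const_mul p).mul
      (((hasDerivAt_profile hr t).pow 2).const_sub 1)
    refine h.congr_deriv ?_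
    simp only [deriv_const, forceFst, hw t ht', habs t ht', profileSlope_sq_add_one hr ht',
      Real.sqrt_sq (inv_pos.2 h1).le, id, Pi.pow_apply]
    rw [profileSlope]
    have hE' := hE t
    generalize √(1 - profile r t ^ 2) = g at h1
    have hpr' : (p - 1) * (r + 1) = p := by linear_combination hpr
    generalize oddPow (r + 1) (t - 1 / 2) = φ at hE' ⊢
    generalize t - 1 / 2 = y at hE' ⊢
    generalize profile r t = f at hE' ⊢
    field_simp
    linear_combination (-2 * p * f) * hE' + f ^ 2 * hpr'
  · intro t ht
    have ht' := Ioo_subset_Icc_self ht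
    have h0 := one_sub_profile_sq_pos hr ht'
    have h1 := Real.sqrt_pos.2 h0
    have h2 := Real.sq_sqrt h0.le
    have h := (((((hasDerivAt_id t).sub_const (1 / 2)).const_mul p).mul
      (hasDerivAt_profile hr t)).mul (hasDerivAt_sqrt_profile hr ht')).neg
    refine h.congr_deriv ?_
    rw [deriv_const, forceSnd, hw t ht', habs t ht', profileSlope_sq_add_one hr ht',
      Real.sqrt_sq (inv_pos.2 h1).le, (hasDerivAt_profileSlope hr ht').deriv]
    simp only [id, Pi.mul_apply]
    have hE' := hE t
    generalize √(1 - profile r t ^ 2) = g at h1 h2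
    have hpr' : (p - 1) * (r + 1) = p := by linear_combination hpr
    generalize oddPow (r + 1) (t - 1 / 2) = φ at hE' ⊢
    generalize t - 1 / 2 = y at hE' ⊢
    generalize profile r t = f at hE' h2 ⊢
    field_simp
    linear_combination (p * y * φ) * h2 - 2 * p * g ^ 2 * hE' + g ^ 2 * f * hpr'

/-! ### Loss of regularity at the inflection point, and the conclusion. -/

/-- If the rectangular elastica is of class `C^{n+2}`, then its profile is of class `C^{n+1}` at
the inflection point. -/
theorem contDiffAt_profile_of_isClassC {p r : ℝ} (hr : 0 < r) {γ : ℝ → Plane}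
    (h : IsVelocity p γ (profileSlope r) fun _ => 1) (hγ : ∀ t, γ t 1 = t) {n : ℕ}
    (hC : IsClassC (n + 2) γ) : ContDiffAt ℝ (n + 1 : ℕ) (profile r) (1 / 2) := by
  obtain ⟨τ, hτm, hτ0, hτL, hτd, hτ⟩ := h.exists_arclength_homeomorph
  set s₀ := τ.symm (1 / 2) with hs₀
  have hτs₀ : τ s₀ = 1 / 2 := τ.apply_symm_apply _
  have hs₀mem : s₀ ∈ Ioo 0 (length γ) := by
    constructor
    · rw [← hτm.lt_iff_lt, hτ0, hτs₀]; norm_num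
    · rw [← hτm.lt_iff_lt, hτL, hτs₀]; norm_num
  have hcd : ContDiffAt ℝ (n + 2 : ℕ) (arclengthParam γ) s₀ :=
    hC.contDiffAt (Icc_mem_nhds hs₀mem.1 hs₀mem.2)
  have hx : ContDiffAt ℝ (n + 2 : ℕ) (fun s => arclengthParam γ s 0) s₀ :=
    (coordCLM 0).contDiff.contDiffAt.comp s₀ hcd
  have hy : ContDiffAt ℝ (n + 2 : ℕ) (fun s => arclengthParam γ s 1) s₀ :=
    (coordCLM 1).contDiff.contDiffAt.comp s₀ hcd
  have hnhds : ∀ᶠ s in 𝓝 s₀, s ∈ Ioo 0 (length γ) := isOpen_Ioo.mem_nhds hs₀mem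
  -- The curve is parametrized by height, so its second arclength coordinate is `τ` itself and
  -- inherits the assumed regularity.
  have hτcd : ContDiffAt ℝ (n + 2 : ℕ) τ s₀ := by
    refine hy.congr_of_eventuallyEq ?_
    filter_upwards [hnhds] with s hs
    rw [hτ s (Ioo_subset_Icc_self hs), hγ]
  have hmem : ∀ s ∈ Ioo 0 (length γ), τ s ∈ Ioo (0 : ℝ) 1 := fun s hs => by
    rw [← hτ0, ← hτL]
    exact ⟨hτm hs.1, hτm hs.2⟩
  have hderiv : ∀ s ∈ Ioo 0 (length γ),
      deriv (fun s => arclengthParam γ s 0) s = profile r (τ s) := by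
    intro s hs
    have hτs := hmem s hs
    have hτs' := Ioo_subset_Icc_self hτs
    have h1 := (hasDerivWithinAt_plane.1 (h.hasDeriv _ hτs')).1.hasDerivAt
      (Icc_mem_nhds hτs.1 hτs.2)
    have h2 := h1.comp s (hτd s hτs')
    have h3 : (fun s => arclengthParam γ s 0) =ᶠ[𝓝 s] (fun t => γ t 0) ∘ τ := by
      filter_upwards [isOpen_Ioo.mem_nhds hs] with s' hs'
      rw [hτ s' (Ioo_subset_Icc_self hs')]
      rfl
    have h4 := Real.sqrt_pos.2 (one_sub_profile_sq_pos hr hτs')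
    rw [h3.deriv_eq, h2.deriv, profileSlope_sq_add_one hr hτs', Real.sqrt_sq (inv_pos.2 h4).le,
      profileSlope]
    field_simp
  have hprof : ContDiffAt ℝ (n + 1 : ℕ) (fun s => profile r (τ s)) s₀ := by
    refine (ContDiffAt.deriv_of_succ (n := n + 1) hx).congr_of_eventuallyEq ?_
    filter_upwards [hnhds] with s hs using (hderiv s hs).symm
  have hτs₀mem : τ s₀ ∈ Icc (0 : ℝ) 1 := Ioo_subset_Icc_self (hmem s₀ hs₀mem)
  -- The tangent is not horizontal at the inflection point, so `τ` has a nonzero derivative there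
  -- and its inverse is equally regular.
  have hsymm : ContDiffAt ℝ (n + 2 : ℕ) τ.symm (1 / 2) := by
    refine τ.toOpenPartialHomeomorph.contDiffAt_symm_deriv
      (f₀' := (√(profileSlope r (τ s₀) ^ 2 + 1 ^ 2))⁻¹) ?_ (mem_univ _) (hτd s₀ hτs₀mem) hτcd
    exact (inv_pos.2 (Real.sqrt_pos.2 (by positivity))).ne'
  have hcomp := ContDiffAt.comp (1 / 2 : ℝ) (g := fun s => profile r (τ s)) (f := τ.symm)
    hprof (hsymm.of_le (by exact_mod_cast Nat.le_succ (n + 1)))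
  refine hcomp.congr_of_eventuallyEq (Eventually.of_forall fun t => ?_)
  simp only [Function.comp, τ.apply_symm_apply]

theorem exists_isPElastica_not_isClassC {p : ℝ} (hp : 1 < p)
    (h : ¬ ∃ m : ℕ, 1 ≤ m ∧ p = 2 * (m : ℝ) / (2 * (m : ℝ) - 1)) :
    ∃ γ : ℝ → Plane, IsPElastica p γ ∧ ¬ IsClassC (2 + ⌈1 / (p - 1)⌉₊) γ := by
  have hp1 : 0 < p - 1 := by linarith
  set r := 1 / (p - 1) with hr
  have hr0 : 0 < r := by positivity
  have hpr : (p - 1) * r = 1 := by rw [hr]; field_simp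
  obtain ⟨γ, hγ, hvel, hγ1⟩ := exists_rectangular_elastica hp hr0 hpr
  refine ⟨γ, hγ, fun hC => h ?_⟩
  rw [add_comm] at hC
  have h1 := contDiffAt_profile_of_isClassC hr0 hvel hγ1 hC
  have h2 : ContDiffAt ℝ (⌈r⌉₊ + 1 : ℕ) (fun y : ℝ => |y| ^ (r + 1)) 0 := by
    have h3 : ContDiffAt ℝ (⌈r⌉₊ + 1 : ℕ) (fun y : ℝ => y + 1 / 2) 0 :=
      contDiffAt_id.add contDiffAt_const
    have h4 : ContDiffAt ℝ (⌈r⌉₊ + 1 : ℕ) (profile r) ((0 : ℝ) + 1 / 2) := by rwa [zero_add]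
    have h5 := contDiffAt_const (c := r + 1).mul (h4.comp (0 : ℝ) h3)
    refine h5.congr_of_eventuallyEq (Eventually.of_forall fun y => ?_)
    have hr1 : r + 1 ≠ 0 := by linarith
    simp only [profile, Function.comp, add_sub_cancel_right]
    field_simp
  -- The defining inequalities of the ceiling put `r + 1` in the window `(⌈r⌉, ⌈r⌉ + 1]`. Smoothness
  -- then forces `r + 1` to be an even integer `2m`.
  obtain ⟨e1, e2⟩ := (eq_of_contDiffAt_abs_rpow ⌈r⌉₊ (r + 1) (Nat.ceil_lt_add_one hr0.le)
    (by linarith [Nat.le_ceil r])).1 h2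
  obtain ⟨m, hm⟩ := e2
  have hm1 : 1 ≤ m := by omega
  refine ⟨m, hm1, ?_⟩
  have hrm : r = 2 * (m : ℝ) - 1 := by
    have : ((⌈r⌉₊ + 1 : ℕ) : ℝ) = ((m + m : ℕ) : ℝ) := by rw [hm]
    push_cast at this
    linarith
  have hrm0 : 2 * (m : ℝ) - 1 ≠ 0 := by rw [← hrm]; exact hr0.ne'
  rw [hrm] at hpr
  rw [eq_div_iff hrm0]
  linarith

end PElastica

end

theorem corollary1p6 (p : ℝ) (hp : 1 < p) :
    ((∀ γ : ℝ → PElastica.Plane, PElastica.IsPElastica p γ → PElastica.IsAnalyticCurve γ) ↔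
      ∃ m : ℕ, 1 ≤ m ∧ p = 2 * (m : ℝ) / (2 * (m : ℝ) - 1)) ∧
    ((¬ ∃ m : ℕ, 1 ≤ m ∧ p = 2 * (m : ℝ) / (2 * (m : ℝ) - 1)) →
      ∃ γ : ℝ → PElastica.Plane, PElastica.IsPElastica p γ ∧
        ¬ PElastica.IsClassC (2 + ⌈1 / (p - 1)⌉₊) γ) := by
  refine ⟨⟨fun h => ?_, fun ⟨m, hm, hpm⟩ γ hγ =>
    PElastica.isAnalyticCurve_of_isPElastica hm hp hpm hγ⟩,
    PElastica.exists_isPElastica_not_isClassC hp⟩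
  by_contra hcon
  obtain ⟨γ, hγ, hC⟩ := PElastica.exists_isPElastica_not_isClassC hp hcon
  -- Passing from analyticity to `C^n` on `[0,L]` uses unique derivatives, hence `L > 0`.
  exact hC ((h γ hγ).contDiffOn (uniqueDiffOn_Icc (by
    obtain ⟨u, v, hv⟩ := hγ.1.exists_isVelocity hp.le
    obtain ⟨τ, hτm, hτ0, hτL, -⟩ := hv.exists_arclength_homeomorph
    rw [← hτm.lt_iff_lt, hτ0, hτL]
    exact zero_lt_one)))
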